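/- **Setting.** Let $n\ge 2$ and let $\Xi=(\Xi_{jk})$ be a real antisymmetric $(n+1)\times(n+1)$ matrix; its upper-left $n\times n$ block is also denoted $\Xi$. The (smooth) quantum torus $\mathbb T^m_\Xi$ ($m=n$ or $n+1$) is the $*$-algebra of series $\sum_{k\in\mathbb Z^m}a_k\,u_1^{k_1}\cdots u_m^{k_m}$ with rapidly decreasing complex coefficients, where $u_j$ are unitaries with $u_ku_j=e^{2\pi i\Xi_{kj}}u_ju_k$. Let $\delta_j$ be the derivation with $\delta_j(u_j)=2\pi i\,u_j$, $\delta_j(u_k)=0$ for $k\ne j$, and $\tau_0(\sum a_ku^k)=a_0$. Put $\Omega^\bullet(\mathbb T^m_\Xi)=\mathbb T^m_\Xi\otimes\bigwedge^\bullet\mathbb C^m$ with $(x\otimes v)(y\otimes w)=xy\otimes v\wedge w$, $(x\otimes v)^*=x^*\otimes\bar v$, and $d(x\otimes v)=\sum_j i\,\delta_j(x)\otimes e_j\wedge v$; write $d\mathbb U_j=1\otimes e_j$. On $\Omega^\bullet(\mathbb T^n_\Xi)$ let $\star_q(x\otimes v)=x\otimes\star v$ with the Euclidean Hodge star $\star$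 of $\bigwedge\mathbb C^n$ (linear, $e_S\wedge\star e_S=e_1\wedge\cdots\wedge e_n$), let $\int x\otimes e_1\wedge\cdots\wedge e_n=\tau_0(x)$ (and $0$ on forms of degree $<n$), and $\langle\mu_1|\mu_2\rangle=\int\mu_1^*\,(\star_q\mu_2)$. **Bundle.** Let $P=\mathbb T^{n+1}_\Xi$, $B=\mathbb T^n_\Xi\subset P$ and $G=\mathbb C[z,z^{-1}]$ the Hopf $*$-algebra of $U(1)$ with counit $\epsilon$ and antipode $S$. The coaction $\Delta_P:P\to P\widehat\otimes G$ is given by $u_j\mapsto u_j\otimes 1$ ($j\le n$), $u_{n+1}\mapsto u_{n+1}\otimes z$. Let $\mathfrak u(1)^\#_{\mathbb C}=\ker\epsilon/(\ker\epsilon)^2$ be the space of invariant $1$-forms of the classical calculus of $U(1)$, with quantum germs map $\pi:G\to\mathfrak u(1)^\#_{\mathbb C}$, basis vector $\vartheta=\pi(z)$, $\pi(g)^*=\pi(S(g)^*)$, and (trivial) adjoint coaction $\mathrm{ad}(\theta)=\theta\otimes 1$. Equip $\Omega^\bullet(P)=\Omega^\bullet(\mathbb T^{n+1}_\Xi)$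 with the coaction $\Delta_\Omega$ of $\Gamma^\wedge=G\oplus G\vartheta$ extending $\Delta_P$ with $d\mathbb U_j\mapsto d\mathbb U_j\otimes1$ ($j\le n$), $d\mathbb U_{n+1}\mapsto d\mathbb U_{n+1}\otimes 1-\tfrac1{2\pi}1\otimes\vartheta$. A quantum principal connection (qpc) is a linear map $\omega:\mathfrak u(1)^\#_{\mathbb C}\to\Omega^1(P)$ with $\Delta_\Omega(\omega(\theta))=(\omega\otimes\mathrm{id})\mathrm{ad}(\theta)+1\otimes\theta$ and $\omega(\theta^*)=\omega(\theta)^*$. The adjoint bundle is the right $B$-module $E_R=\mathrm{Mor}(\mathrm{ad},\Delta_P)$ of linear maps $T:\mathfrak u(1)^\#_{\mathbb C}\to P$ with $\Delta_P\circ T=(T\otimes\mathrm{id})\circ\mathrm{ad}$; it is freely generated by $T^{\mathrm{triv}}$, $T^{\mathrm{triv}}(\vartheta)=1$, and has the Hermitian structure $\langle T_1,T_2\rangle=T_1(\vartheta)^*T_2(\vartheta)\in B$, extended to $E_R\otimes_B\Omega^\bullet(B)$ by $\langle T_1\otimes\mu_1,T_2\otimes\mu_2\rangle=\mu_1^*\langle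 T_1,T_2\rangle\mu_2$. A quantum linear connection (qlc) is a linear map $\widehat\nabla:E_R\to E_R\otimes_B\Omega^1(B)$ with $\widehat\nabla(Tb)=\widehat\nabla(T)b+T\otimes_B db$; it is compatible with the metric if $\langle T_1,\widehat\nabla T_2\rangle-\langle\widehat\nabla T_1,T_2\rangle=d\langle T_1,T_2\rangle$ for all $T_1,T_2$. A qpc $\omega$ induces the gauge qlc $\widehat\nabla^\omega(T)=T^{\mathrm{triv}}\otimes_B\widehat D^\omega(T)(\vartheta)$, where $\widehat D^\omega(T)(\theta)=d(T(\theta))+\omega(\pi(S^{-1}(\theta^{(1)})))\,T(\theta^{(0)})$ and $\mathrm{ad}(\theta)=\theta^{(0)}\otimes\theta^{(1)}$. For a qlc $\widehat\nabla$ put $d^{\widehat\nabla}(T\otimes_B\mu)=\widehat\nabla(T)\mu+T\otimes_B d\mu$ and $R^{\widehat\nabla}=d^{\widehat\nabla}\circ\widehat\nabla$, and for a right $B$-linear $\Lambda:E_R\to E_R\otimes_B\Omega^k(B)$ put $[\widehat\nabla,\Lambda]=d^{\widehat\nabla}\circ\Lambda-(-1)^k\Lambda^{\mathrm{ext}}\circ\widehat\nabla$,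 with $\Lambda^{\mathrm{ext}}(T\otimes_B\mu)=\Lambda(T)\mu$. On such maps use the inner product $\langle\!\langle\Lambda_1|\Lambda_2\rangle\!\rangle=\langle\Lambda_1(T^{\mathrm{triv}})|\Lambda_2(T^{\mathrm{triv}})\rangle$, where $\langle T_1\otimes\mu_1|T_2\otimes\mu_2\rangle=\langle\mu_1|\langle T_1,T_2\rangle\mu_2\rangle$. The qlc $\widehat\nabla$ is a *Yang–Mills qlc* if the operator $\Lambda\mapsto[\widehat\nabla,\Lambda]$ from the right $B$-linear maps $E_R\to E_R\otimes_B\Omega^1(B)$ to those into $E_R\otimes_B\Omega^2(B)$ has a formal adjoint $[\widehat\nabla,-]^\star$ for these inner products and $[\widehat\nabla,-]^\star R^{\widehat\nabla}=0$. **Theorem.** Let $\omega$ be a qpc, let $\widehat\nabla$ be a qlc of $E_R$ compatible with the metric, and write $\widehat\nabla=\widehat\nabla^\omega+\widehat\Lambda$ with $\widehat\Lambda:E_R\to E_R\otimes_B\Omega^1(B)$ right $B$-linear and $\widehat\Lambda(T^{\mathrm{triv}})=T^{\mathrm{triv}}\otimes_B\mu$, $\mu\in\Omega^1(\mathbb T^n_\Xi)$.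 Then $\widehat\nabla$ is a Yang–Mills qlc if and only if $$d(\star_q(d\mu+\mu\mu))+\mu\,\star_q(d\mu+\mu\mu)+(-1)^{n-1}\star_q(d\mu+\mu\mu)\,\mu=0 .$$ -/

import Mathlib

open scoped TensorProduct LaurentPolynomial

noncomputable section

namespace QTor

/-! ## The smooth quantum torus -/

/-- The polynomial weight `1 + |m₁| + ⋯ + |mₙ|` on `ℤⁿ`. -/
def weight {n : ℕ} (m : Fin n → ℤ) : ℝ := 1 + ∑ j, |(m j : ℝ)|

lemma one_le_weight {n : ℕ} (m : Fin n → ℤ) : 1 ≤ weight m :=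
  le_add_of_nonneg_right (Finset.sum_nonneg fun _ _ => abs_nonneg _)

lemma weight_pos {n : ℕ} (m : Fin n → ℤ) : 0 < weight m :=
  lt_of_lt_of_le one_pos (one_le_weight m)

lemma weight_neg {n : ℕ} (m : Fin n → ℤ) : weight (-m) = weight m := by
  simp [weight]

lemma weight_add_le {n : ℕ} (m l : Fin n → ℤ) : weight (m + l) ≤ weight m * weight l := by
  have h : ∑ j, |((m j + l j : ℤ) : ℝ)| ≤ ∑ j, |(m j : ℝ)| + ∑ j, |(l j : ℝ)| := by
    rw [← Finset.sum_add_distrib]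
    refine Finset.sum_le_sum fun j _ => ?_
    push_cast
    exact abs_add_le _ _
  have h1 : 0 ≤ ∑ j, |(m j : ℝ)| := Finset.sum_nonneg fun _ _ => abs_nonneg _
  have h2 : 0 ≤ ∑ j, |(l j : ℝ)| := Finset.sum_nonneg fun _ _ => abs_nonneg _
  simp only [weight, Pi.add_apply]
  nlinarith [mul_nonneg h1 h2]

lemma summable_prod_inv (n : ℕ) :
    Summable fun m : Fin n → ℤ => ∏ j, ((1 + |(m j : ℝ)|) ^ 2)⁻¹ := by
  have h1 : Summable fun k : ℤ => ((1 + |(k : ℝ)|) ^ 2)⁻¹ := by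
    have h0 : Summable fun k : ℕ => ((1 + |((k : ℤ) : ℝ)|) ^ 2)⁻¹ := by
      have := (summable_nat_add_iff 1).2 (Real.summable_nat_pow_inv.2 one_lt_two)
      refine this.congr fun k => ?_
      push_cast
      rw [abs_of_nonneg (by positivity), add_comm]
    refine Summable.of_nat_of_neg h0 (h0.congr fun k => ?_)
    simp
  induction n with
  | zero => exact Summable.of_finite
  | succ n ih =>
    rw [← (Fin.consEquiv fun _ : Fin (n + 1) => ℤ).summable_iff]
    refine (h1.mul_of_nonneg ih (fun _ => by positivity) fun _ => by positivity).congr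
      fun p => ?_
    simp [Fin.prod_univ_succ, Fin.consEquiv, mul_comm]

lemma summable_weight (n : ℕ) :
    Summable fun m : Fin n → ℤ => (weight m ^ (2 * n))⁻¹ := by
  refine Summable.of_nonneg_of_le (fun m => by have := weight_pos m; positivity) (fun m => ?_)
    (summable_prod_inv n)
  rw [Finset.prod_inv_distrib]
  refine inv_anti₀ (by positivity) ?_
  calc ∏ j, (1 + |(m j : ℝ)|) ^ 2 ≤ ∏ _j : Fin n, weight m ^ 2 := by
        refine Finset.prod_le_prod (fun _ _ => by positivity) fun j _ => ?_
        refine pow_le_pow_left₀ (by positivity) ?_ 2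
        exact add_le_add_right (Finset.single_le_sum (f := fun j => |(m j : ℝ)|)
          (fun _ _ => abs_nonneg _) (Finset.mem_univ j)) 1
    _ = weight m ^ (2 * n) := by simp [pow_mul]

/-- The exponent of the commutation phase of ordered monomials:
`u^m u^l = exp (2πi ∑_{j<k} m_k Ξ_{kj} l_j) u^{m+l}`. -/
def ordForm {n : ℕ} (Ξ : Matrix (Fin n) (Fin n) ℝ) (m l : Fin n → ℤ) : ℝ :=
  ∑ k, ∑ j, if j < k then (m k : ℝ) * Ξ k j * (l j : ℝ) else 0

/-- The phase relating `u^m u^l` to `u^{m+l}`. -/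
def phase {n : ℕ} (Ξ : Matrix (Fin n) (Fin n) ℝ) (m l : Fin n → ℤ) : ℂ :=
  Complex.exp (2 * Real.pi * Complex.I * (ordForm Ξ m l : ℂ))

section Phase

variable {n : ℕ} (Ξ : Matrix (Fin n) (Fin n) ℝ) (m m' l l' : Fin n → ℤ)

lemma ordForm_add_left : ordForm Ξ (m + m') l = ordForm Ξ m l + ordForm Ξ m' l := by
  simp only [ordForm, ← Finset.sum_add_distrib]
  refine Finset.sum_congr rfl fun k _ => Finset.sum_congr rfl fun j _ => ?_
  split_ifs
  · simp only [Pi.add_apply]; push_cast; ring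
  · simp

lemma ordForm_add_right : ordForm Ξ m (l + l') = ordForm Ξ m l + ordForm Ξ m l' := by
  simp only [ordForm, ← Finset.sum_add_distrib]
  refine Finset.sum_congr rfl fun k _ => Finset.sum_congr rfl fun j _ => ?_
  split_ifs
  · simp only [Pi.add_apply]; push_cast; ring
  · simp

lemma ordForm_zero_left : ordForm Ξ 0 l = 0 := by simp [ordForm]

lemma ordForm_zero_right : ordForm Ξ m 0 = 0 := by simp [ordForm]

lemma ordForm_neg_left : ordForm Ξ (-m) l = -ordForm Ξ m l := by
  have := ordForm_add_left Ξ m (-m) l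
  rw [add_neg_cancel, ordForm_zero_left] at this
  linarith

lemma ordForm_neg_right : ordForm Ξ m (-l) = -ordForm Ξ m l := by
  have := ordForm_add_right Ξ m l (-l)
  rw [add_neg_cancel, ordForm_zero_right] at this
  linarith

lemma ordForm_sub_left : ordForm Ξ (m - m') l = ordForm Ξ m l - ordForm Ξ m' l := by
  rw [sub_eq_add_neg, ordForm_add_left, ordForm_neg_left, sub_eq_add_neg]

lemma ordForm_sub_right : ordForm Ξ m (l - l') = ordForm Ξ m l - ordForm Ξ m l' := by
  rw [sub_eq_add_neg, ordForm_add_right, ordForm_neg_right, sub_eq_add_neg]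

lemma norm_phase : ‖phase Ξ m l‖ = 1 := by
  have : (2 * Real.pi * Complex.I * (ordForm Ξ m l : ℂ) : ℂ)
      = ((2 * Real.pi * ordForm Ξ m l : ℝ) : ℂ) * Complex.I := by push_cast; ring
  rw [phase, this, Complex.norm_exp_ofReal_mul_I]

lemma conj_phase : (starRingEnd ℂ) (phase Ξ m l) = phase Ξ (-m) l := by
  rw [phase, phase, ← Complex.exp_conj, ordForm_neg_left]
  congr 1
  simp only [map_mul, Complex.conj_I, Complex.conj_ofReal, map_ofNat]
  push_cast
  ring

lemma phase_zero_left : phase Ξ 0 l = 1 := by simp [phase, ordForm_zero_left]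

lemma phase_zero_right : phase Ξ m 0 = 1 := by simp [phase, ordForm_zero_right]

lemma phase_cocycle (k : Fin n → ℤ) :
    phase Ξ l (m - l) * phase Ξ k (l - k) = phase Ξ k (m - k) * phase Ξ (l - k) (m - l) := by
  simp only [phase, ← Complex.exp_add, ordForm_sub_left, ordForm_sub_right]
  congr 1
  push_cast
  ring

lemma phase_star (k : Fin n → ℤ) :
    phase Ξ (-(k - m)) (-k) * phase Ξ m m
      = phase Ξ k (m - k) * (phase Ξ k k * phase Ξ (m - k) (m - k)) := by
  simp only [phase, ← Complex.exp_add, ordForm_sub_left, ordForm_sub_right, ordForm_neg_left,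
    ordForm_neg_right]
  congr 1
  push_cast
  ring

end Phase

/-- The smooth quantum `n`-torus `𝕋ⁿ_Ξ`: the element with coefficients `a` stands for the formal sum
`∑ a_m u₁^{m₁} ⋯ uₙ^{mₙ}` with a rapidly decaying family `a`. -/
@[ext]
structure QTorus {n : ℕ} (Ξ : Matrix (Fin n) (Fin n) ℝ) where
  /-- the coefficient of `u₁^{m₁} ⋯ uₙ^{mₙ}` -/
  coeff : (Fin n → ℤ) → ℂ
  /-- the coefficients decay faster than the inverse of any polynomial -/
  rapid : ∀ N : ℕ, ∃ C : ℝ, ∀ m, weight m ^ N * ‖coeff m‖ ≤ C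

namespace QTorus

variable {n : ℕ} {Ξ : Matrix (Fin n) (Fin n) ℝ}

lemma summable_weight_mul (a : QTorus Ξ) (N : ℕ) :
    Summable fun m => weight m ^ N * ‖a.coeff m‖ := by
  obtain ⟨C, hC⟩ := a.rapid (N + 2 * n)
  refine Summable.of_nonneg_of_le (fun m => by have := weight_pos m; positivity) (fun m => ?_)
    ((summable_weight n).mul_left C)
  have hw := weight_pos m
  rw [← div_eq_mul_inv, le_div_iff₀ (by positivity)]
  calc _ = weight m ^ (N + 2 * n) * ‖a.coeff m‖ := by ring
    _ ≤ C := hC m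

lemma summable_norm (a : QTorus Ξ) : Summable fun m => ‖a.coeff m‖ := by
  simpa using a.summable_weight_mul 0

lemma bounded (a : QTorus Ξ) : ∃ C : ℝ, 0 ≤ C ∧ ∀ m, ‖a.coeff m‖ ≤ C := by
  obtain ⟨C, hC⟩ := a.rapid 0
  exact ⟨C, (norm_nonneg (a.coeff 0)).trans (by simpa using hC 0), fun m => by simpa using hC m⟩

instance : Zero (QTorus Ξ) := ⟨⟨0, fun _ => ⟨0, by simp⟩⟩⟩

instance : One (QTorus Ξ) :=
  ⟨⟨fun m => if m = 0 then 1 else 0, fun N => ⟨1, fun m => by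
    by_cases h : m = 0 <;> simp [h, weight]⟩⟩⟩

instance : Add (QTorus Ξ) :=
  ⟨fun a b => ⟨fun m => a.coeff m + b.coeff m, fun N => by
    obtain ⟨C, hC⟩ := a.rapid N
    obtain ⟨D, hD⟩ := b.rapid N
    refine ⟨C + D, fun m => ?_⟩
    calc _ ≤ weight m ^ N * (‖a.coeff m‖ + ‖b.coeff m‖) :=
          mul_le_mul_of_nonneg_left (norm_add_le _ _) (by have := weight_pos m; positivity)
      _ ≤ C + D := by rw [mul_add]; exact add_le_add (hC m) (hD m)⟩⟩

instance : SMul ℂ (QTorus Ξ) :=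
  ⟨fun c a => ⟨fun m => c * a.coeff m, fun N => by
    obtain ⟨C, hC⟩ := a.rapid N
    refine ⟨‖c‖ * C, fun m => ?_⟩
    calc _ = ‖c‖ * (weight m ^ N * ‖a.coeff m‖) := by rw [norm_mul]; ring
      _ ≤ ‖c‖ * C := mul_le_mul_of_nonneg_left (hC m) (norm_nonneg _)⟩⟩

@[simp] lemma coeff_zero (m : Fin n → ℤ) : (0 : QTorus Ξ).coeff m = 0 := rfl

lemma coeff_one (m : Fin n → ℤ) : (1 : QTorus Ξ).coeff m = if m = 0 then 1 else 0 := rfl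

@[simp] lemma coeff_add (a b : QTorus Ξ) (m : Fin n → ℤ) :
    (a + b).coeff m = a.coeff m + b.coeff m := rfl

@[simp] lemma coeff_smul (c : ℂ) (a : QTorus Ξ) (m : Fin n → ℤ) :
    (c • a).coeff m = c * a.coeff m := rfl

instance : Neg (QTorus Ξ) := ⟨fun a => (-1 : ℂ) • a⟩

@[simp] lemma coeff_neg (a : QTorus Ξ) (m : Fin n → ℤ) : (-a).coeff m = -a.coeff m := by
  change (-1 : ℂ) * a.coeff m = _
  ring

instance : AddCommGroup (QTorus Ξ) where
  add_assoc a b c := by ext m; simp [add_assoc]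
  zero_add a := by ext m; simp
  add_zero a := by ext m; simp
  add_comm a b := by ext m; simp [add_comm]
  neg_add_cancel a := by ext m; simp
  nsmul := nsmulRec
  zsmul := zsmulRec

instance : Module ℂ (QTorus Ξ) where
  one_smul a := by ext m; simp
  mul_smul c d a := by ext m; simp [mul_assoc]
  smul_zero c := by ext m; simp
  smul_add c a b := by ext m; simp [mul_add]
  add_smul c d a := by ext m; simp [add_mul]
  zero_smul a := by ext m; simp

lemma summable_conv (a b : QTorus Ξ) (m : Fin n → ℤ) :
    Summable fun l => phase Ξ l (m - l) * a.coeff l * b.coeff (m - l) := by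
  obtain ⟨C, hC0, hC⟩ := b.bounded
  refine Summable.of_norm_bounded (a.summable_norm.mul_right C) fun l => ?_
  rw [norm_mul, norm_mul, norm_phase, one_mul]
  exact mul_le_mul_of_nonneg_left (hC _) (norm_nonneg _)

/-- The product determined by `u_k u_j = exp (2πi Ξ_{kj}) u_j u_k`, i.e. by
`u^m u^l = phase Ξ m l • u^{m+l}` on ordered monomials. -/
instance : Mul (QTorus Ξ) :=
  ⟨fun a b => ⟨fun m => ∑' l, phase Ξ l (m - l) * a.coeff l * b.coeff (m - l), fun N => by
    obtain ⟨D, hD⟩ := b.rapid N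
    have hs := (a.summable_weight_mul N).mul_right D
    refine ⟨∑' l, weight l ^ N * ‖a.coeff l‖ * D, fun m => ?_⟩
    have hm : 0 ≤ weight m ^ N := by have := weight_pos m; positivity
    have hw : weight m ^ N = ‖((weight m ^ N : ℝ) : ℂ)‖ := by
      rw [Complex.norm_real, Real.norm_of_nonneg hm]
    rw [hw, ← norm_mul, ← tsum_mul_left]
    refine tsum_of_norm_bounded hs.hasSum fun l => ?_
    rw [norm_mul, ← hw, norm_mul, norm_mul, norm_phase, one_mul]
    have h1 : weight m ^ N ≤ weight l ^ N * weight (m - l) ^ N := by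
      rw [← mul_pow]
      refine pow_le_pow_left₀ (weight_pos m).le ?_ N
      simpa using weight_add_le l (m - l)
    calc _ ≤ weight l ^ N * weight (m - l) ^ N * (‖a.coeff l‖ * ‖b.coeff (m - l)‖) :=
          mul_le_mul_of_nonneg_right h1 (by positivity)
      _ = weight l ^ N * ‖a.coeff l‖ * (weight (m - l) ^ N * ‖b.coeff (m - l)‖) := by ring
      _ ≤ _ := mul_le_mul_of_nonneg_left (hD _) (by have := weight_pos l; positivity)⟩⟩

lemma coeff_mul (a b : QTorus Ξ) (m : Fin n → ℤ) :
    (a * b).coeff m = ∑' l, phase Ξ l (m - l) * a.coeff l * b.coeff (m - l) := rfl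

lemma mul_assoc' (a b c : QTorus Ξ) : a * b * c = a * (b * c) := by
  ext m
  let F : (Fin n → ℤ) → (Fin n → ℤ) → ℂ := fun l k =>
    phase Ξ l (m - l) * phase Ξ k (l - k) * a.coeff k * b.coeff (l - k) * c.coeff (m - l)
  obtain ⟨C, hC0, hC⟩ := c.bounded
  have hF : Summable (Function.uncurry F) := by
    have h0 := (b.summable_norm.mul_of_nonneg a.summable_norm (fun _ => norm_nonneg _)
      fun _ => norm_nonneg _).mul_right C
    let e : (Fin n → ℤ) × (Fin n → ℤ) ≃ (Fin n → ℤ) × (Fin n → ℤ) :=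
      { toFun := fun p => (p.1 - p.2, p.2)
        invFun := fun p => (p.1 + p.2, p.2)
        left_inv := fun p => by simp
        right_inv := fun p => by simp }
    refine Summable.of_norm_bounded (e.summable_iff.2 h0) ?_
    rintro ⟨l, k⟩
    simp only [Function.uncurry, F, norm_mul, norm_phase, one_mul, Function.comp, e,
      Equiv.coe_fn_mk]
    rw [mul_comm ‖a.coeff k‖]
    exact mul_le_mul_of_nonneg_left (hC _) (by positivity)
  have hL : (a * b * c).coeff m = ∑' l, ∑' k, F l k := by
    rw [coeff_mul]
    refine tsum_congr fun l => ?_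
    rw [coeff_mul, ← tsum_mul_left, ← tsum_mul_right]
    refine tsum_congr fun k => ?_
    simp only [F]; ring
  have hR : (a * (b * c)).coeff m = ∑' k, ∑' l, F l k := by
    rw [coeff_mul]
    refine tsum_congr fun k => ?_
    rw [coeff_mul, ← tsum_mul_left, ← (Equiv.subRight k).tsum_eq]
    refine tsum_congr fun l => ?_
    have e1 : m - k - (l - k) = m - l := by abel
    simp only [F, Equiv.subRight_apply, e1, phase_cocycle Ξ m l k]
    ring
  rw [hL, hR]
  exact hF.tsum_comm.symm

instance : Ring (QTorus Ξ) where
  __ := (inferInstance : AddCommGroup (QTorus Ξ))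
  mul_assoc := mul_assoc'
  one_mul a := by
    ext m
    rw [coeff_mul, tsum_eq_single 0 fun l hl => by simp [coeff_one, hl]]
    simp [coeff_one, phase_zero_left]
  mul_one a := by
    ext m
    rw [coeff_mul, tsum_eq_single m fun l hl => by simp [coeff_one, sub_eq_zero, hl.symm]]
    simp [coeff_one, phase_zero_right]
  left_distrib a b c := by
    ext m
    rw [coeff_add, coeff_mul, coeff_mul, coeff_mul,
      ← (summable_conv a b m).tsum_add (summable_conv a c m)]
    refine tsum_congr fun l => ?_
    rw [coeff_add]; ring
  right_distrib a b c := by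
    ext m
    rw [coeff_add, coeff_mul, coeff_mul, coeff_mul,
      ← (summable_conv a c m).tsum_add (summable_conv b c m)]
    refine tsum_congr fun l => ?_
    rw [coeff_add]; ring
  zero_mul a := by ext m; simp [coeff_mul]
  mul_zero a := by ext m; simp [coeff_mul]

instance : Algebra ℂ (QTorus Ξ) :=
  Algebra.ofModule
    (fun c a b => by
      ext m
      rw [coeff_mul, coeff_smul, coeff_mul, ← tsum_mul_left]
      refine tsum_congr fun l => ?_
      rw [coeff_smul]; ring)
    (fun c a b => by
      ext m
      rw [coeff_mul, coeff_smul, coeff_mul, ← tsum_mul_left]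
      refine tsum_congr fun l => ?_
      rw [coeff_smul]; ring)

/-- The `*`-operation with `u_j^* = u_j⁻¹`, so that `(u^m)^* = phase Ξ m m • u^{-m}`. -/
instance : Star (QTorus Ξ) :=
  ⟨fun a => ⟨fun m => phase Ξ m m * (starRingEnd ℂ) (a.coeff (-m)), fun N => by
    obtain ⟨C, hC⟩ := a.rapid N
    refine ⟨C, fun m => ?_⟩
    rw [norm_mul, norm_phase, one_mul, RCLike.norm_conj, ← weight_neg]
    exact hC (-m)⟩⟩

lemma coeff_star (a : QTorus Ξ) (m : Fin n → ℤ) :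
    (star a).coeff m = phase Ξ m m * (starRingEnd ℂ) (a.coeff (-m)) := rfl

instance : StarRing (QTorus Ξ) where
  star_involutive a := by
    ext m
    have h : phase Ξ m m * phase Ξ (-(-m)) (-m) = 1 := by
      simp only [phase, ← Complex.exp_add, ordForm_neg_left, ordForm_neg_right]
      rw [Complex.exp_eq_one_iff]
      exact ⟨0, by push_cast; ring⟩
    rw [coeff_star, coeff_star, map_mul, conj_phase, neg_neg, Complex.conj_conj, ← mul_assoc]
    rw [neg_neg] at h
    rw [h, one_mul]
  star_add a b := by
    ext m
    simp only [coeff_star, coeff_add, map_add, mul_add]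
  star_mul a b := by
    ext m
    rw [coeff_star, coeff_mul, coeff_mul, Complex.conj_tsum, ← tsum_mul_left,
      ← (Equiv.subRight m).tsum_eq]
    refine tsum_congr fun k => ?_
    have e1 : -m - (k - m) = -k := by abel
    have e2 : -(m - k) = k - m := by abel
    simp only [Equiv.subRight_apply, e1, coeff_star, map_mul, conj_phase, e2]
    calc _ = (phase Ξ (-(k - m)) (-k) * phase Ξ m m) * ((starRingEnd ℂ) (a.coeff (k - m)) *
          (starRingEnd ℂ) (b.coeff (-k))) := by ring
      _ = _ := by rw [phase_star]; ring

instance : StarModule ℂ (QTorus Ξ) where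
  star_smul c a := by
    ext m
    simp only [coeff_star, coeff_smul, map_mul, RCLike.star_def]
    ring

/-- The `*`-preserving derivation with `δ_j(u_j) = 2πi u_j` and `δ_j(u_k) = 0` for `k ≠ j`. -/
def delta (j : Fin n) : QTorus Ξ →ₗ[ℂ] QTorus Ξ where
  toFun a := ⟨fun m => 2 * Real.pi * Complex.I * (m j : ℂ) * a.coeff m, fun N => by
    obtain ⟨C, hC⟩ := a.rapid (N + 1)
    refine ⟨2 * Real.pi * C, fun m => ?_⟩
    have h1 : |(m j : ℝ)| ≤ weight m :=
      (Finset.single_le_sum (f := fun j => |(m j : ℝ)|) (fun _ _ => abs_nonneg _)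
        (Finset.mem_univ j)).trans (le_add_of_nonneg_left zero_le_one)
    have hw := weight_pos m
    have h2 : ‖(2 * Real.pi * Complex.I * (m j : ℂ) * a.coeff m : ℂ)‖
        = 2 * Real.pi * (|(m j : ℝ)| * ‖a.coeff m‖) := by
      simp only [norm_mul, Complex.norm_I, Complex.norm_real, Complex.norm_intCast,
        Complex.norm_ofNat, Real.norm_of_nonneg Real.pi_pos.le]
      ring
    rw [h2]
    calc _ = 2 * Real.pi * (weight m ^ N * (|(m j : ℝ)| * ‖a.coeff m‖)) := by ring
      _ ≤ 2 * Real.pi * (weight m ^ N * (weight m * ‖a.coeff m‖)) := by gcongr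
      _ = 2 * Real.pi * (weight m ^ (N + 1) * ‖a.coeff m‖) := by ring
      _ ≤ 2 * Real.pi * C := by gcongr; exact hC m⟩
  map_add' a b := by ext m; simp only [coeff_add]; ring
  map_smul' c a := by ext m; simp only [coeff_smul, RingHom.id_apply]; ring

lemma coeff_delta (j : Fin n) (a : QTorus Ξ) (m : Fin n → ℤ) :
    (delta j a).coeff m = 2 * Real.pi * Complex.I * (m j : ℂ) * a.coeff m := rfl

lemma delta_mul (j : Fin n) (a b : QTorus Ξ) :
    delta j (a * b) = delta j a * b + a * delta j b := by
  ext m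
  rw [coeff_add, coeff_delta, coeff_mul, coeff_mul, coeff_mul,
    ← (summable_conv (delta j a) b m).tsum_add (summable_conv a (delta j b) m), ← tsum_mul_left]
  refine tsum_congr fun l => ?_
  simp only [coeff_delta, Pi.sub_apply]
  push_cast
  ring

lemma delta_comm (j k : Fin n) (a : QTorus Ξ) : delta j (delta k a) = delta k (delta j a) := by
  ext m
  simp only [coeff_delta]
  ring

/-- The tracial state `τ₀`, the coefficient of the unit. -/
def trace : QTorus Ξ →ₗ[ℂ] ℂ where
  toFun a := a.coeff 0
  map_add' _ _ := rfl
  map_smul' _ _ := rfl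

end QTorus


/-! ## The quantum group `U(1)` and its classical calculus -/

/-- The polynomial functions on `U(1)`, with the generator `z = T 1`. -/
abbrev G := ℂ[T;T⁻¹]

/-- The counit of `G`. -/
abbrev counitG : G →ₐ[ℂ] ℂ := Bialgebra.counitAlgHom ℂ G

/-- The quantum dual Lie algebra `Ker ε / Ker² ε` of the classical calculus of `U(1)`. -/
def U1Dual : Type := (RingHom.ker counitG).Cotangent

instance : AddCommGroup U1Dual := inferInstanceAs (AddCommGroup (RingHom.ker counitG).Cotangent)

instance : Module ℂ U1Dual := inferInstanceAs (Module ℂ (RingHom.ker counitG).Cotangent)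

/-- The class `[g]` of an element of `Ker ε`. -/
def cls : ((RingHom.ker counitG).restrictScalars ℂ) →ₗ[ℂ] U1Dual :=
  ((RingHom.ker counitG).toCotangent.restrictScalars ℂ :
    (RingHom.ker counitG) →ₗ[ℂ] (RingHom.ker counitG).Cotangent)

lemma counitG_T (k : ℤ) : counitG (LaurentPolynomial.T k) = 1 := by
  simp [counitG]

/-- The projection `g ↦ g - ε(g) 1` onto `Ker ε`. -/
def projKer : G →ₗ[ℂ] ((RingHom.ker counitG).restrictScalars ℂ) :=
  (LinearMap.id - (Algebra.linearMap ℂ G).comp counitG.toLinearMap).codRestrict _ (by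
    intro g
    change counitG (g - algebraMap ℂ G (counitG g)) = 0
    simp)

/-- The quantum germs map `π(g) = i [g - ε(g) 1]`. -/
def germ : G →ₗ[ℂ] U1Dual := Complex.I • cls.comp projKer

/-- The generator `ϑ = π(z)`. -/
def theta : U1Dual := germ (LaurentPolynomial.T 1)

/-- The derivative at the unit, `∑ g_k z^k ↦ ∑ k g_k`. -/
def derivOne : G →ₗ[ℂ] ℂ where
  toFun g := g.coeff.sum fun k a => (k : ℂ) * a
  map_add' g h := by
    rw [AddMonoidAlgebra.coeff_add, Finsupp.sum_add_index] <;> intros <;> ring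
  map_smul' c g := by
    rw [AddMonoidAlgebra.coeff_smul, Finsupp.sum_smul_index (by simp), RingHom.id_apply, smul_eq_mul, Finsupp.mul_sum]
    exact Finsupp.sum_congr fun k _ => by ring

lemma derivOne_T (k : ℤ) : derivOne (LaurentPolynomial.T k) = k := by
  change (Finsupp.single k (1 : ℂ)).sum _ = _
  simp

lemma derivOne_mul (g h : G) :
    derivOne (g * h) = derivOne g * counitG h + counitG g * derivOne h := by
  have hC : ∀ a : ℂ, (LaurentPolynomial.C a : G) = algebraMap ℂ G a := fun _ => rfl
  induction g using LaurentPolynomial.induction_on' with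
  | add p q hp hq => simp only [add_mul, map_add, hp, hq]; ring
  | C_mul_T k a =>
    induction h using LaurentPolynomial.induction_on' with
    | add p q hp hq => simp only [mul_add, map_add, hp, hq]; ring
    | C_mul_T l b =>
      have e : (LaurentPolynomial.C a * LaurentPolynomial.T k *
          (LaurentPolynomial.C b * LaurentPolynomial.T l) : G)
          = (a * b) • LaurentPolynomial.T (k + l) := by
        rw [LaurentPolynomial.T_add, hC, hC, Algebra.smul_def, map_mul]; ring
      rw [e, hC, hC, ← Algebra.smul_def, ← Algebra.smul_def]
      simp only [map_smul, derivOne_T, counitG_T, smul_eq_mul]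
      push_cast; ring

/-- The coordinate on the line spanned by `ϑ`. -/
def coord : U1Dual →ₗ[ℂ] ℂ :=
  (Ideal.Cotangent.lift
    (((-Complex.I) • derivOne).comp ((RingHom.ker counitG).restrictScalars ℂ).subtype)
    (by
      intro x y
      have hx : counitG (x : G) = 0 := x.2
      have hy : counitG (y : G) = 0 := y.2
      have h : derivOne ((x : G) * (y : G)) = 0 := by rw [derivOne_mul, hx, hy]; ring
      change -Complex.I • derivOne ((x : G) * (y : G)) = 0
      rw [h, smul_zero]) : (RingHom.ker counitG).Cotangent →ₗ[ℂ] ℂ)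

lemma coord_germ (g : G) : coord (germ g) = derivOne g := by
  have h1 : derivOne (algebraMap ℂ G (counitG g)) = 0 := by
    have := derivOne_mul 1 1
    rw [mul_one, map_one counitG] at this
    have h0 : derivOne (1 : G) = 0 := by linear_combination -this
    rw [Algebra.algebraMap_eq_smul_one, map_smul, h0, smul_zero]
  change coord (Complex.I • cls (projKer g)) = _
  rw [map_smul]
  change Complex.I • (-Complex.I • derivOne (g - algebraMap ℂ G (counitG g))) = _
  rw [map_sub, h1, sub_zero, smul_smul, mul_neg, Complex.I_mul_I, neg_neg, one_smul]

lemma coord_theta : coord theta = 1 := by simp [theta, coord_germ, derivOne_T]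

/-- The right adjoint coaction `Ad(g) = g^{(2)} ⊗ S(g^{(1)}) g^{(3)}`. -/
def AdG : G →ₗ[ℂ] G ⊗[ℂ] G :=
  TensorProduct.lift
      ((LinearMap.mul ℂ (G ⊗[ℂ] G)).comp
          ((TensorProduct.mk ℂ G G 1).comp (HopfAlgebra.antipode ℂ)))
    ∘ₗ (LinearMap.lTensor G Coalgebra.comul) ∘ₗ Coalgebra.comul

/-- The adjoint coaction on the quantum dual Lie algebra; see `ad_germ`. -/
def ad : U1Dual →ₗ[ℂ] U1Dual ⊗[ℂ] G := (TensorProduct.mk ℂ U1Dual G).flip 1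

lemma ad_apply (θ : U1Dual) : ad θ = θ ⊗ₜ 1 := rfl

/-- The defining property of `ad`: it is induced by `Ad` through the germs map. -/
lemma ad_germ (g : G) : ad (germ g) = germ.rTensor G (AdG g) := by
  have hC : ∀ a : ℂ, (LaurentPolynomial.C a : G) = algebraMap ℂ G a := fun _ => rfl
  induction g using LaurentPolynomial.induction_on' with
  | add p q hp hq => simp only [map_add, hp, hq]
  | C_mul_T k a =>
    have h : AdG (LaurentPolynomial.T k) = LaurentPolynomial.T k ⊗ₜ 1 := by
      simp only [AdG, LinearMap.comp_apply, LaurentPolynomial.comul_T,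
        LinearMap.lTensor_tmul, TensorProduct.lift.tmul, LaurentPolynomial.antipode_T,
        TensorProduct.mk_apply, LinearMap.mul_apply', Algebra.TensorProduct.tmul_mul_tmul, one_mul]
      rw [← LaurentPolynomial.T_add, neg_add_cancel, LaurentPolynomial.T_zero]
    rw [hC, ← Algebra.smul_def]
    simp only [map_smul, h, LinearMap.rTensor_tmul, ad_apply]

/-- The `*`-operation of `G`, the antilinear involution with `z^* = z⁻¹`. -/
def starG (g : G) : G := LaurentPolynomial.invert (AddMonoidAlgebra.map (starRingEnd ℂ).toAddMonoidHom g)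

lemma starG_T (k : ℤ) : starG (LaurentPolynomial.T k) = LaurentPolynomial.T (-k) := by
  have h : AddMonoidAlgebra.map (starRingEnd ℂ).toAddMonoidHom (LaurentPolynomial.T k : G)
      = LaurentPolynomial.T k := by
    rw [LaurentPolynomial.T, AddMonoidAlgebra.map_single]
    simp [-LaurentPolynomial.single_eq_C_mul_T]
  rw [starG, h, LaurentPolynomial.invert_T]

/-! ## The inclusion of the `n`-torus in the `(n+1)`-torus -/

section Bundle

variable {n : ℕ}

/-- The parameter matrix of the subalgebra generated by the first `n` generators. -/
def baseMat (Ξ : Matrix (Fin (n + 1)) (Fin (n + 1)) ℝ) : Matrix (Fin n) (Fin n) ℝ :=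
  Ξ.submatrix Fin.castSucc Fin.castSucc

/-- The base algebra `B = 𝕋ⁿ`. -/
abbrev Base (Ξ : Matrix (Fin (n + 1)) (Fin (n + 1)) ℝ) := QTorus (baseMat Ξ)

/-- Extend a multi-index by the exponent `k` of the last generator. -/
def idx (k : ℤ) (m : Fin n → ℤ) : Fin (n + 1) → ℤ := Fin.snoc (α := fun _ => ℤ) m k

/-- Drop the exponent of the last generator. -/
def cut (m : Fin (n + 1) → ℤ) : Fin n → ℤ := fun j => m j.castSucc

@[simp] lemma idx_last (k : ℤ) (m : Fin n → ℤ) : idx k m (Fin.last n) = k := by simp [idx]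

@[simp] lemma idx_castSucc (k : ℤ) (m : Fin n → ℤ) (j : Fin n) : idx k m j.castSucc = m j := by
  simp [idx]

@[simp] lemma cut_idx (k : ℤ) (m : Fin n → ℤ) : cut (idx k m) = m := by
  funext j; simp [cut]

lemma idx_cut (m : Fin (n + 1) → ℤ) : idx (m (Fin.last n)) (cut m) = m := by
  funext j
  refine Fin.lastCases ?_ (fun j => ?_) j <;> simp [cut]

lemma idx_sub (k l : ℤ) (m m' : Fin n → ℤ) : idx k m - idx l m' = idx (k - l) (m - m') := by
  funext j
  refine Fin.lastCases ?_ (fun j => ?_) j <;> simp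

lemma weight_idx_zero (m : Fin n → ℤ) : weight (idx 0 m) = weight m := by
  simp [weight, Fin.sum_univ_castSucc]

lemma phase_idx (Ξ : Matrix (Fin (n + 1)) (Fin (n + 1)) ℝ) (m l : Fin n → ℤ) :
    phase Ξ (idx 0 m) (idx 0 l) = phase (baseMat Ξ) m l := by
  have h : ordForm Ξ (idx 0 m) (idx 0 l) = ordForm (baseMat Ξ) m l := by
    simp [ordForm, Fin.sum_univ_castSucc, baseMat]
  rw [phase, phase, h]

variable {Ξ : Matrix (Fin (n + 1)) (Fin (n + 1)) ℝ}

/-- The underlying function of the inclusion `B ⊆ P`. -/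
def inclFun (a : Base Ξ) : QTorus Ξ where
  coeff m := if m (Fin.last n) = 0 then a.coeff (cut m) else 0
  rapid N := by
    obtain ⟨C, hC⟩ := a.rapid N
    refine ⟨C, fun m => ?_⟩
    split_ifs with h
    · have e := idx_cut m
      rw [h] at e
      rw [← e, weight_idx_zero, cut_idx]
      exact hC _
    · have h0 := hC 0
      rw [norm_zero, mul_zero]
      exact le_trans (by have := weight_pos (0 : Fin n → ℤ); positivity) h0

lemma coeff_mul_incl (x : QTorus Ξ) (b : Base Ξ) (m : Fin (n + 1) → ℤ) :
    (x * inclFun b).coeff m = ∑' j : Fin n → ℤ,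
      phase Ξ (m - idx 0 j) (idx 0 j) * x.coeff (m - idx 0 j) * b.coeff j := by
  have hinj : Function.Injective (idx (n := n) 0) := fun j j' h => by
    rw [← cut_idx 0 j, h, cut_idx]
  rw [QTorus.coeff_mul, ← (Equiv.subLeft m).tsum_eq]
  rw [← hinj.tsum_eq]
  · refine tsum_congr fun j => ?_
    simp [inclFun]
  · intro l hl
    by_contra hne
    have h0 : l (Fin.last n) ≠ 0 := fun h => hne ⟨cut l, by rw [← h, idx_cut]⟩
    simp [inclFun, h0] at hl

/-- The inclusion `B ⊆ P` of the `n`-torus in the `(n+1)`-torus, with `u_j ↦ u_j`. -/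
def incl : Base Ξ →ₐ[ℂ] QTorus Ξ :=
  AlgHom.ofLinearMap
    { toFun := inclFun
      map_add' := fun a b => by
        ext m
        simp only [inclFun, QTorus.coeff_add]
        split_ifs <;> simp
      map_smul' := fun c a => by
        ext m
        simp [inclFun] }
    (by
      ext m
      change (if m (Fin.last n) = 0 then (1 : Base Ξ).coeff (cut m) else 0) = _
      rw [QTorus.coeff_one, QTorus.coeff_one]
      by_cases h : m = 0
      · subst h
        have : cut (0 : Fin (n + 1) → ℤ) = 0 := rfl
        simp [this]
      · by_cases h1 : m (Fin.last n) = 0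
        · have h2 : cut m ≠ 0 := fun h2 => h (by
            rw [← idx_cut m, h1, h2]
            funext j
            refine Fin.lastCases ?_ (fun j => ?_) j <;> simp)
          simp [h, h2]
        · simp [h, h1])
    (fun a b => by
      change inclFun (a * b) = inclFun a * inclFun b
      ext m
      rw [coeff_mul_incl]
      change (if m (Fin.last n) = 0 then (a * b).coeff (cut m) else 0) = _
      by_cases h : m (Fin.last n) = 0
      · have e := idx_cut m
        rw [h] at e
        rw [if_pos h, QTorus.coeff_mul, ← (Equiv.subLeft (cut m)).tsum_eq]
        refine tsum_congr fun j => ?_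
        rw [← e]
        simp only [idx_sub, sub_zero, phase_idx, inclFun, idx_last, if_true, cut_idx,
          Equiv.subLeft_apply, sub_sub_cancel]
      · rw [if_neg h]
        simp [inclFun, h])

lemma incl_coeff (a : Base Ξ) (m : Fin (n + 1) → ℤ) :
    (incl a).coeff m = if m (Fin.last n) = 0 then a.coeff (cut m) else 0 := rfl

lemma incl_star (a : Base Ξ) : (incl (star a) : QTorus Ξ) = star (incl a) := by
  ext m
  rw [incl_coeff, QTorus.coeff_star (incl a), incl_coeff]
  by_cases h : m (Fin.last n) = 0
  · have e := idx_cut m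
    rw [h] at e
    have hp : phase Ξ m m = phase (baseMat Ξ) (cut m) (cut m) := by
      rw [← phase_idx, e]
    have h1 : (-m) (Fin.last n) = 0 := by simp [h]
    rw [if_pos h, if_pos h1, QTorus.coeff_star, hp]
    rfl
  · have h1 : (-m) (Fin.last n) ≠ 0 := by simpa using h
    rw [if_neg h, if_neg h1, map_zero, mul_zero]

/-- The coefficient of `u_{n+1}^0`; on elements of `B ⊆ P` it inverts the inclusion. -/
def res : QTorus Ξ →ₗ[ℂ] Base Ξ where
  toFun x := ⟨fun m => x.coeff (idx 0 m), fun N => by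
    obtain ⟨C, hC⟩ := x.rapid N
    exact ⟨C, fun m => by rw [← weight_idx_zero]; exact hC _⟩⟩
  map_add' _ _ := rfl
  map_smul' _ _ := rfl

lemma res_incl (b : Base Ξ) : res (incl b) = b := by
  ext m
  change (incl b).coeff (idx 0 m) = _
  simp [incl_coeff]

lemma res_mul_incl (x : QTorus Ξ) (b : Base Ξ) : res (x * incl b) = res x * b := by
  ext m
  rw [QTorus.coeff_mul, ← (Equiv.subLeft m).tsum_eq]
  refine (coeff_mul_incl x b (idx 0 m)).trans (tsum_congr fun j => ?_)
  simp only [idx_sub, sub_zero, phase_idx, Equiv.subLeft_apply, sub_sub_cancel]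
  rfl

/-- The part of degree `k` in the last generator. -/
def wt (k : ℤ) : QTorus Ξ →ₗ[ℂ] QTorus Ξ where
  toFun x := ⟨fun m => if m (Fin.last n) = k then x.coeff m else 0, fun N => by
    obtain ⟨C, hC⟩ := x.rapid N
    refine ⟨C, fun m => ?_⟩
    split_ifs
    · exact hC m
    · refine le_trans ?_ (hC m)
      rw [norm_zero, mul_zero]
      have := weight_pos m; positivity⟩
  map_add' x y := by
    ext m
    simp only [QTorus.coeff_add]
    split_ifs <;> simp
  map_smul' c x := by
    ext m
    simp

lemma coeff_wt (k : ℤ) (x : QTorus Ξ) (m : Fin (n + 1) → ℤ) :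
    (wt k x).coeff m = if m (Fin.last n) = k then x.coeff m else 0 := rfl

lemma wt_mul_incl (k : ℤ) (x : QTorus Ξ) (b : Base Ξ) :
    wt k (x * incl b) = wt k x * incl b := by
  ext m
  rw [coeff_wt]
  change _ = (wt k x * inclFun b).coeff m
  rw [coeff_mul_incl]
  change (if _ then (x * inclFun b).coeff m else 0) = _
  rw [coeff_mul_incl]
  split_ifs with h
  · exact tsum_congr fun j => by simp [coeff_wt, h]
  · simp [coeff_wt, h]

lemma incl_res (x : QTorus Ξ) : incl (res x) = wt 0 x := by
  ext m
  rw [incl_coeff, coeff_wt]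
  split_ifs with h
  · change x.coeff (idx 0 (cut m)) = _
    rw [← h, idx_cut]
  · rfl

end Bundle

/-! ## Differential forms -/

section FormsSec

variable {n : ℕ}

/-- The exterior algebra of `ℝⁿ`; its complexification is the exterior algebra of `ℂⁿ`. -/
abbrev Ext (n : ℕ) := ExteriorAlgebra ℝ (Fin n → ℝ)

/-- The algebra of differential forms `𝕋ⁿ_Ξ ⊗ ⋀ ℂⁿ = 𝕋ⁿ_Ξ ⊗_ℝ ⋀ ℝⁿ`. -/
def Forms (Ξ : Matrix (Fin n) (Fin n) ℝ) : Type := QTorus Ξ ⊗[ℝ] Ext n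

variable {Ξ : Matrix (Fin n) (Fin n) ℝ}

/-- The product `(x₁ ⊗ v₁)(x₂ ⊗ v₂) = x₁ x₂ ⊗ v₁ ∧ v₂`; see `form_mul`. -/
instance : Ring (Forms Ξ) := inferInstanceAs (Ring (QTorus Ξ ⊗[ℝ] Ext n))

instance : Algebra ℂ (Forms Ξ) := inferInstanceAs (Algebra ℂ (QTorus Ξ ⊗[ℝ] Ext n))

/-- The form `x ⊗ v`. -/
def form (x : QTorus Ξ) (v : Ext n) : Forms Ξ := (x ⊗ₜ[ℝ] v : QTorus Ξ ⊗[ℝ] Ext n)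

lemma form_mul (x y : QTorus Ξ) (v w : Ext n) : form x v * form y w = form (x * y) (v * w) :=
  Algebra.TensorProduct.tmul_mul_tmul x y v w

lemma form_add_left (x y : QTorus Ξ) (v : Ext n) : form (x + y) v = form x v + form y v :=
  TensorProduct.add_tmul x y v

lemma form_neg_right (x : QTorus Ξ) (v : Ext n) : form x (-v) = -form x v :=
  TensorProduct.tmul_neg x v

lemma form_smul_left (c : ℂ) (x : QTorus Ξ) (v : Ext n) : form (c • x) v = c • form x v := rfl

lemma form_induction {p : Forms Ξ → Prop} (h0 : p 0) (hf : ∀ x v, p (form x v))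
    (ha : ∀ φ ψ, p φ → p ψ → p (φ + ψ)) (φ : Forms Ξ) : p φ :=
  TensorProduct.induction_on (motive := p) φ h0 hf ha

/-- The form `dU_j = 1 ⊗ e_j`, as an element of the exterior algebra. -/
def gen (j : Fin n) : Ext n := ExteriorAlgebra.ι ℝ (Pi.single j 1)

/-- Elements of the algebra as forms of degree zero. -/
def ofAlg : QTorus Ξ →ₐ[ℂ] Forms Ξ :=
  (Algebra.TensorProduct.includeLeft : QTorus Ξ →ₐ[ℂ] QTorus Ξ ⊗[ℝ] Ext n)

lemma ofAlg_apply (x : QTorus Ξ) : ofAlg x = form x 1 := rfl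

/-- The differential forms of degree `k`. -/
def deg (Ξ : Matrix (Fin n) (Fin n) ℝ) (k : ℕ) : Submodule ℂ (Forms Ξ) :=
  Submodule.span ℂ {φ | ∃ (x : QTorus Ξ), ∃ v ∈ (⋀[ℝ]^k (Fin n → ℝ) : Submodule ℝ (Ext n)),
    φ = form x v}

/-- The differential, `d(x ⊗ v) = ∑_j i δ_j(x) ⊗ e_j ∧ v`. -/
def d : Forms Ξ →ₗ[ℂ] Forms Ξ :=
  (∑ j, TensorProduct.AlgebraTensorModule.map (Complex.I • QTorus.delta j)
    (LinearMap.mulLeft ℝ (gen j)) : QTorus Ξ ⊗[ℝ] Ext n →ₗ[ℂ] QTorus Ξ ⊗[ℝ] Ext n)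

lemma d_form (x : QTorus Ξ) (v : Ext n) :
    d (form x v) = ∑ j, form (Complex.I • QTorus.delta j x) (gen j * v) := by
  have h : (∑ j, TensorProduct.AlgebraTensorModule.map (Complex.I • QTorus.delta j)
      (LinearMap.mulLeft ℝ (gen j)) : QTorus Ξ ⊗[ℝ] Ext n →ₗ[ℂ] QTorus Ξ ⊗[ℝ] Ext n) (x ⊗ₜ[ℝ] v)
      = ∑ j, (Complex.I • QTorus.delta j x) ⊗ₜ[ℝ] (gen j * v) := by
    rw [LinearMap.sum_apply]; rfl
  exact h

/-- The `*`-operation, `(x ⊗ v)^* = x^* ⊗ v` for real `v`. -/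
def starF : Forms Ξ →+ Forms Ξ :=
  (TensorProduct.map
    { toFun := star
      map_add' := star_add
      map_smul' := fun r x => by
        change star ((r : ℂ) • x) = (r : ℂ) • star x
        rw [star_smul]
        simp }
    LinearMap.id : QTorus Ξ ⊗[ℝ] Ext n →ₗ[ℝ] QTorus Ξ ⊗[ℝ] Ext n).toAddMonoidHom

lemma starF_form (x : QTorus Ξ) (v : Ext n) : starF (form x v) = form (star x) v := rfl

lemma starF_ofAlg_mul (x : QTorus Ξ) (φ : Forms Ξ) :
    starF (ofAlg x * φ) = starF φ * ofAlg (star x) := by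
  induction φ using form_induction with
  | h0 => simp
  | ha φ ψ h1 h2 => simp only [mul_add, map_add, h1, h2, add_mul]
  | hf y v =>
    rw [ofAlg_apply, ofAlg_apply, form_mul, starF_form, starF_form, form_mul, one_mul, mul_one,
      star_mul]

/-- The basis `e_{j₁} ∧ ⋯ ∧ e_{j_k}`, `j₁ < ⋯ < j_k`, of the exterior algebra. -/
def basisExt (n : ℕ) : Module.Basis (Finset (Fin n)) ℝ (Ext n) :=
  Module.Basis.ExteriorAlgebra (Pi.basisFun ℝ (Fin n))

/-- The Hodge star operator of `⋀ ℝⁿ`: `⋆e_s` is `± e_{sᶜ}` with the sign for which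
`e_s ∧ ⋆e_s = e₁ ∧ ⋯ ∧ eₙ`. -/
def hodge (n : ℕ) : Ext n →ₗ[ℝ] Ext n :=
  (basisExt n).constr ℝ fun s =>
    (basisExt n).coord Finset.univ (basisExt n s * basisExt n sᶜ) • basisExt n sᶜ

/-- The quantum Hodge operator `⋆_q(x ⊗ v) = x ⊗ ⋆v`. -/
def hodgeQ : Forms Ξ →ₗ[ℂ] Forms Ξ :=
  (TensorProduct.AlgebraTensorModule.map LinearMap.id (hodge n) :
    QTorus Ξ ⊗[ℝ] Ext n →ₗ[ℂ] QTorus Ξ ⊗[ℝ] Ext n)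

lemma hodgeQ_form (x : QTorus Ξ) (v : Ext n) : hodgeQ (form x v) = form x (hodge n v) := rfl

lemma hodgeQ_ofAlg_mul (x : QTorus Ξ) (φ : Forms Ξ) :
    hodgeQ (ofAlg x * φ) = ofAlg x * hodgeQ φ := by
  induction φ using form_induction with
  | h0 => simp
  | ha φ ψ h1 h2 => simp only [mul_add, map_add, h1, h2]
  | hf y v => rw [ofAlg_apply, form_mul, hodgeQ_form, hodgeQ_form, form_mul, one_mul, one_mul]

/-- The quantum integral `∫ x dvol = τ₀(x)`, extended by zero to forms of lower degree. -/
def integral : Forms Ξ →ₗ[ℂ] ℂ :=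
  (TensorProduct.AlgebraTensorModule.lift
    { toFun := fun x =>
        { toFun := fun v => ((basisExt n).coord Finset.univ v : ℂ) * QTorus.trace x
          map_add' := fun v w => by rw [map_add]; push_cast; ring
          map_smul' := fun r v => by
            rw [map_smul, RingHom.id_apply, smul_eq_mul, Complex.real_smul]; push_cast; ring }
      map_add' := fun x y => by
        ext v
        change _ * QTorus.trace (x + y) = _ * QTorus.trace x + _ * QTorus.trace y
        rw [map_add, mul_add]
      map_smul' := fun c x => by
        ext v
        change _ * QTorus.trace (c • x) = c * (_ * QTorus.trace x)
        rw [map_smul, smul_eq_mul]; ring } : QTorus Ξ ⊗[ℝ] Ext n →ₗ[ℂ] ℂ)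

lemma integral_form (x : QTorus Ξ) (v : Ext n) :
    integral (form x v) = ((basisExt n).coord Finset.univ v : ℂ) * QTorus.trace x := rfl

/-- The inner product of forms, `⟨μ₁ | μ₂⟩ = ∫ μ₁^* ⋆_q μ₂`. -/
def ip (μ₁ μ₂ : Forms Ξ) : ℂ := integral (starF μ₁ * hodgeQ μ₂)

lemma gen_mem (j : Fin n) : gen j ∈ (⋀[ℝ]^1 (Fin n → ℝ) : Submodule ℝ (Ext n)) := by
  unfold ExteriorAlgebra.exteriorPower; rw [pow_one]; exact ⟨_, rfl⟩

lemma gen_mul_gen (j k : Fin n) : gen j * gen k = -(gen k * gen j) :=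
  eq_neg_of_add_eq_zero_left (ExteriorAlgebra.ι_add_mul_swap _ _)

lemma form_mem_deg {k : ℕ} (x : QTorus Ξ) {v : Ext n}
    (hv : v ∈ (⋀[ℝ]^k (Fin n → ℝ) : Submodule ℝ (Ext n))) : form x v ∈ deg Ξ k :=
  Submodule.subset_span ⟨x, v, hv, rfl⟩

lemma mul_mem_deg {k l : ℕ} {φ ψ : Forms Ξ} (hφ : φ ∈ deg Ξ k) (hψ : ψ ∈ deg Ξ l) :
    φ * ψ ∈ deg Ξ (k + l) := by
  induction hφ using Submodule.span_induction with
  | mem φ h =>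
    obtain ⟨x, v, hv, rfl⟩ := h
    induction hψ using Submodule.span_induction with
    | mem ψ h =>
      obtain ⟨y, w, hw, rfl⟩ := h
      rw [form_mul]
      refine form_mem_deg _ ?_
      unfold ExteriorAlgebra.exteriorPower at hv hw ⊢
      rw [pow_add]
      exact Submodule.mul_mem_mul hv hw
    | zero => rw [mul_zero]; exact zero_mem _
    | add φ ψ _ _ h1 h2 => rw [mul_add]; exact add_mem h1 h2
    | smul c φ _ h => rw [mul_smul_comm]; exact Submodule.smul_mem _ _ h
  | zero => rw [zero_mul]; exact zero_mem _
  | add φ ψ _ _ h1 h2 => rw [add_mul]; exact add_mem h1 h2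
  | smul c φ _ h => rw [smul_mul_assoc]; exact Submodule.smul_mem _ _ h

lemma d_mem_deg {k : ℕ} {φ : Forms Ξ} (hφ : φ ∈ deg Ξ k) : d φ ∈ deg Ξ (k + 1) := by
  induction hφ using Submodule.span_induction with
  | mem φ h =>
    obtain ⟨x, v, hv, rfl⟩ := h
    rw [d_form]
    refine Submodule.sum_mem _ fun j _ => form_mem_deg _ ?_
    have hj := gen_mem j
    unfold ExteriorAlgebra.exteriorPower at hv hj ⊢
    rw [add_comm, pow_add]
    exact Submodule.mul_mem_mul hj hv
  | zero => rw [map_zero]; exact zero_mem _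
  | add φ ψ _ _ h1 h2 => rw [map_add]; exact add_mem h1 h2
  | smul c φ _ h => rw [map_smul]; exact Submodule.smul_mem _ _ h

lemma ofAlg_mem_deg (x : QTorus Ξ) : ofAlg x ∈ deg Ξ 0 :=
  form_mem_deg x (by unfold ExteriorAlgebra.exteriorPower; rw [pow_zero]; exact Submodule.one_le.1 le_rfl)

lemma d_ofAlg_mul (x : QTorus Ξ) (φ : Forms Ξ) :
    d (ofAlg x * φ) = d (ofAlg x) * φ + ofAlg x * d φ := by
  induction φ using form_induction with
  | h0 => simp
  | ha φ ψ h1 h2 => simp only [mul_add, map_add, h1, h2]; abel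
  | hf y v =>
    simp only [ofAlg_apply, form_mul, one_mul, d_form,
      Finset.sum_mul, Finset.mul_sum, ← Finset.sum_add_distrib]
    refine Finset.sum_congr rfl fun j _ => ?_
    rw [QTorus.delta_mul, smul_add, form_add_left, mul_one, smul_mul_assoc,
      mul_smul_comm]

lemma mul_gen {k : ℕ} {v : Ext n} (hv : v ∈ (⋀[ℝ]^k (Fin n → ℝ) : Submodule ℝ (Ext n)))
    (j : Fin n) : v * gen j = (-1 : ℝ) ^ k • (gen j * v) := by
  unfold ExteriorAlgebra.exteriorPower at hv
  induction hv using Submodule.pow_induction_on_left' with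
  | algebraMap r => rw [pow_zero, one_smul]; exact Algebra.commutes r _
  | add v w k hv hw h1 h2 => rw [add_mul, mul_add, h1, h2, smul_add]
  | mem_mul m hm k v hv h =>
    obtain ⟨m, rfl⟩ := hm
    have h1 : ExteriorAlgebra.ι ℝ m * gen j = -(gen j * ExteriorAlgebra.ι ℝ m) :=
      eq_neg_of_add_eq_zero_left (ExteriorAlgebra.ι_add_mul_swap _ _)
    rw [mul_assoc, h, mul_smul_comm, ← mul_assoc, h1, neg_mul, smul_neg, pow_succ, mul_neg_one,
      neg_smul, mul_assoc]

lemma form_smul_right (r : ℝ) (x : QTorus Ξ) (v : Ext n) :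
    form x (r • v) = (r : ℂ) • form x v :=
  (TensorProduct.smul_tmul r x v).symm

lemma d_mul_ofAlg {k : ℕ} {φ : Forms Ξ} (hφ : φ ∈ deg Ξ k) (x : QTorus Ξ) :
    d (φ * ofAlg x) = d φ * ofAlg x + (-1 : ℂ) ^ k • (φ * d (ofAlg x)) := by
  induction hφ using Submodule.span_induction with
  | mem φ h =>
    obtain ⟨y, v, hv, rfl⟩ := h
    simp only [ofAlg_apply, form_mul, mul_one, d_form,
      Finset.sum_mul, Finset.mul_sum, Finset.smul_sum, ← Finset.sum_add_distrib]
    refine Finset.sum_congr rfl fun j _ => ?_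
    have h1 : (-1 : ℂ) ^ k * ((-1 : ℝ) ^ k : ℝ) = 1 := by
      push_cast
      rw [← mul_pow]; simp
    rw [QTorus.delta_mul, smul_add, form_add_left, mul_gen hv, form_smul_right, smul_smul, h1,
      one_smul, smul_mul_assoc, mul_smul_comm]
  | zero => simp
  | add φ ψ _ _ h1 h2 => simp only [add_mul, map_add, h1, h2, smul_add]; abel
  | smul c φ _ h =>
    simp only [smul_mul_assoc, map_smul, h, smul_add]
    rw [smul_comm]

lemma d_d (φ : Forms Ξ) : d (d φ) = 0 := by
  induction φ using form_induction with
  | h0 => simp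
  | ha φ ψ h1 h2 => simp only [map_add, h1, h2, add_zero]
  | hf x v =>
    rw [d_form, map_sum]
    simp only [d_form]
    have h : ∀ S : Forms Ξ, S = -S → S = 0 := fun S hS => by
      have h2 : (2 : ℂ) • S = 0 := by
        rw [two_smul]; nth_rewrite 2 [hS]; exact add_neg_cancel S
      exact (smul_eq_zero.1 h2).resolve_left two_ne_zero
    apply h
    conv_lhs => rw [Finset.sum_comm]
    simp only [← Finset.sum_neg_distrib]
    refine Finset.sum_congr rfl fun j _ => Finset.sum_congr rfl fun k _ => ?_
    rw [map_smul, map_smul, QTorus.delta_comm, ← mul_assoc, ← mul_assoc, gen_mul_gen, neg_mul,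
      form_neg_right]

end FormsSec

/-! ## The quantum principal `U(1)`-bundle -/

section Main

variable {n : ℕ} {Ξ : Matrix (Fin (n + 1)) (Fin (n + 1)) ℝ}

/-- Elements of `M ⊗ G` as formal Laurent series in `z` with coefficients in `M`. -/
def toFormal (M : Type*) [AddCommGroup M] [Module ℂ M] : M ⊗[ℂ] G →ₗ[ℂ] (ℤ → M) :=
  TensorProduct.lift
    { toFun := fun p =>
        { toFun := fun g k => g.coeff k • p
          map_add' := fun g h => by funext k; simp [add_smul]
          map_smul' := fun c g => by funext k; simp [mul_smul] }
      map_add' := fun p q => by ext g k; simp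
      map_smul' := fun c p => LinearMap.ext fun g => funext fun k => smul_comm _ _ _ }

lemma toFormal_tmul {M : Type*} [AddCommGroup M] [Module ℂ M] (p : M) (g : G) (k : ℤ) :
    toFormal M (p ⊗ₜ g) k = g.coeff k • p := rfl

/-- The coaction `Δ_P` with `u_j ↦ u_j ⊗ 1` for `j ≤ n` and `u_{n+1} ↦ u_{n+1} ⊗ z`. For a rapidly
decaying series the values lie in the completion of `P ⊗ G`, so they are recorded as formal Laurent
series in `z` with coefficients in `P`. -/
def coactP : QTorus Ξ →ₗ[ℂ] (ℤ → QTorus Ξ) := LinearMap.pi wt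

/-- The corepresentation morphisms `Mor(ad, Δ_P)`. -/
def MorAd (Ξ : Matrix (Fin (n + 1)) (Fin (n + 1)) ℝ) : Submodule ℂ (U1Dual →ₗ[ℂ] QTorus Ξ) where
  carrier := {T | ∀ θ, coactP (T θ) = toFormal (QTorus Ξ) (T.rTensor G (ad θ))}
  add_mem' {T S} hT hS θ := by
    rw [LinearMap.add_apply, map_add, hT θ, hS θ, LinearMap.rTensor_add, LinearMap.add_apply,
      map_add]
  zero_mem' θ := by simp
  smul_mem' c T hT θ := by
    rw [LinearMap.smul_apply, map_smul, hT θ, LinearMap.rTensor_smul, LinearMap.smul_apply,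
      map_smul]

lemma mem_MorAd_iff (T : U1Dual →ₗ[ℂ] QTorus Ξ) : T ∈ MorAd Ξ ↔ ∀ θ, wt 0 (T θ) = T θ := by
  have hone : ∀ k : ℤ, (1 : G).coeff k = if k = 0 then 1 else 0 := fun k => by
    change (Finsupp.single (0 : ℤ) (1 : ℂ)) k = _
    rw [Finsupp.single_apply]
    exact if_congr eq_comm rfl rfl
  constructor
  · intro h θ
    have h1 := congrFun (h θ) 0
    rw [ad_apply, LinearMap.rTensor_tmul, toFormal_tmul, hone, if_pos rfl, one_smul] at h1
    exact h1
  · intro h θ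
    funext k
    rw [ad_apply, LinearMap.rTensor_tmul, toFormal_tmul, hone, ← h θ]
    ext m
    change (wt k (wt 0 (T θ))).coeff m = _
    rw [coeff_wt]
    by_cases hk : k = 0
    · subst hk
      rw [coeff_wt, if_pos rfl, one_smul]
      split_ifs with h1
      · exact (if_pos h1).symm
      · exact (if_neg h1).symm
    · simp only [coeff_wt, hk, if_false, zero_smul, QTorus.coeff_zero]
      split_ifs with h1 h2
      · exact absurd (h1.symm.trans h2) hk
      · rfl
      · rfl

/-- The right `B`-module `E_R = Mor(ad, Δ_P)` of sections of the adjoint bundle. -/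
def Sec (Ξ : Matrix (Fin (n + 1)) (Fin (n + 1)) ℝ) : Type := MorAd Ξ

instance : AddCommGroup (Sec Ξ) := inferInstanceAs (AddCommGroup (MorAd Ξ))

instance : Module ℂ (Sec Ξ) := inferInstanceAs (Module ℂ (MorAd Ξ))

/-- The linear map `U1Dual → P` underlying a section. -/
def Sec.val : Sec Ξ →ₗ[ℂ] (U1Dual →ₗ[ℂ] QTorus Ξ) := (MorAd Ξ).subtype

lemma Sec.ext {T S : Sec Ξ} (h : ∀ θ, Sec.val T θ = Sec.val S θ) : T = S :=
  Subtype.ext (LinearMap.ext h)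

/-- The right action of `B` on sections, `(T · b)(θ) = T(θ) b`. -/
def secMul (b : Base Ξ) : Sec Ξ →ₗ[ℂ] Sec Ξ where
  toFun T := ⟨(LinearMap.mulRight ℂ (incl b)).comp (Sec.val T), by
    rw [mem_MorAd_iff]
    intro θ
    have h := (mem_MorAd_iff (Sec.val T)).1 T.2 θ
    simp only [LinearMap.comp_apply, LinearMap.mulRight_apply, wt_mul_incl, h]⟩
  map_add' T S := Subtype.ext (by
    change (LinearMap.mulRight ℂ (incl b)).comp (Sec.val (T + S)) = _
    rw [map_add, LinearMap.comp_add]; rfl)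
  map_smul' c T := Subtype.ext (by
    change (LinearMap.mulRight ℂ (incl b)).comp (Sec.val (c • T)) = _
    rw [map_smul, LinearMap.comp_smul]; rfl)

instance : Module (Base Ξ)ᵐᵒᵖ (Sec Ξ) where
  smul b T := secMul b.unop T
  one_smul T := by
    refine Sec.ext fun θ => ?_
    change Sec.val T θ * incl 1 = _
    rw [map_one, mul_one]
  mul_smul a b T := by
    refine Sec.ext fun θ => ?_
    change Sec.val T θ * incl (b.unop * a.unop) = Sec.val T θ * incl b.unop * incl a.unop
    rw [map_mul, mul_assoc]
  smul_zero b := map_zero _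
  smul_add b T S := map_add _ _ _
  add_smul a b T := by
    refine Sec.ext fun θ => ?_
    change Sec.val T θ * incl (a.unop + b.unop) = Sec.val T θ * incl a.unop + Sec.val T θ * incl b.unop
    rw [map_add, mul_add]
  zero_smul T := by
    refine Sec.ext fun θ => ?_
    change Sec.val T θ * incl 0 = 0
    rw [map_zero, mul_zero]

lemma sec_smul_apply (b : Base Ξ) (T : Sec Ξ) (θ : U1Dual) :
    Sec.val (MulOpposite.op b • T) θ = Sec.val T θ * incl b := rfl

lemma secMul_apply (b : Base Ξ) (T : Sec Ξ) : secMul b T = MulOpposite.op b • T := rfl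

/-- The section `T^triv(w ϑ) = w 1`. -/
def secTriv (Ξ : Matrix (Fin (n + 1)) (Fin (n + 1)) ℝ) : Sec Ξ :=
  ⟨coord.smulRight (1 : QTorus Ξ), by
    rw [mem_MorAd_iff]
    intro θ
    rw [LinearMap.smulRight_apply, map_smul]
    congr 1
    ext m
    rw [coeff_wt, QTorus.coeff_one]
    by_cases h : m = 0
    · simp [h]
    · simp [h]⟩

lemma secTriv_theta : Sec.val (secTriv Ξ) theta = 1 := by
  change coord theta • (1 : QTorus Ξ) = 1
  rw [coord_theta, one_smul]

/-! ## Section-valued forms and connections -/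

/-- The relations `T · b ⊗ μ = T ⊗ b μ`. -/
def balance (Ξ : Matrix (Fin (n + 1)) (Fin (n + 1)) ℝ) :
    Submodule ℂ (Sec Ξ ⊗[ℂ] Forms (baseMat Ξ)) :=
  Submodule.span ℂ {φ | ∃ (T : Sec Ξ) (b : Base Ξ) (μ : Forms (baseMat Ξ)),
    φ = (MulOpposite.op b • T) ⊗ₜ μ - T ⊗ₜ (ofAlg b * μ)}

/-- The space `E_R ⊗_B Ω^•(B)`. -/
def SecForms (Ξ : Matrix (Fin (n + 1)) (Fin (n + 1)) ℝ) : Type :=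
  (Sec Ξ ⊗[ℂ] Forms (baseMat Ξ)) ⧸ balance Ξ

instance : AddCommGroup (SecForms Ξ) :=
  inferInstanceAs (AddCommGroup ((Sec Ξ ⊗[ℂ] Forms (baseMat Ξ)) ⧸ balance Ξ))

instance : Module ℂ (SecForms Ξ) :=
  inferInstanceAs (Module ℂ ((Sec Ξ ⊗[ℂ] Forms (baseMat Ξ)) ⧸ balance Ξ))

/-- The projection onto `E_R ⊗_B Ω^•(B)`. -/
def proj (Ξ : Matrix (Fin (n + 1)) (Fin (n + 1)) ℝ) :
    Sec Ξ ⊗[ℂ] Forms (baseMat Ξ) →ₗ[ℂ] SecForms Ξ := (balance Ξ).mkQ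

/-- The element `T ⊗_B μ`. -/
def tens (T : Sec Ξ) (μ : Forms (baseMat Ξ)) : SecForms Ξ := proj Ξ (T ⊗ₜ μ)

lemma tens_smul_left (b : Base Ξ) (T : Sec Ξ) (μ : Forms (baseMat Ξ)) :
    tens (MulOpposite.op b • T) μ = tens T (ofAlg b * μ) := by
  refine (Submodule.Quotient.eq _).2 ?_
  exact Submodule.subset_span ⟨T, b, μ, rfl⟩

lemma tens_add_left (T S : Sec Ξ) (μ : Forms (baseMat Ξ)) :
    tens (T + S) μ = tens T μ + tens S μ := by
  rw [tens, TensorProduct.add_tmul, map_add]; rfl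

lemma tens_smulC_left (c : ℂ) (T : Sec Ξ) (μ : Forms (baseMat Ξ)) :
    tens (c • T) μ = c • tens T μ := by
  rw [tens, ← TensorProduct.smul_tmul', map_smul]; rfl

/-- `T ⊗_B μ` as a bilinear map. -/
def tensL : Sec Ξ →ₗ[ℂ] Forms (baseMat Ξ) →ₗ[ℂ] SecForms Ξ :=
  (TensorProduct.mk ℂ _ _).compr₂ (proj Ξ)

lemma tensL_apply (T : Sec Ξ) (μ : Forms (baseMat Ξ)) : tensL T μ = tens T μ := rfl

lemma secForms_induction {p : SecForms Ξ → Prop} (h0 : p 0)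
    (ht : ∀ T μ, p (tens T μ)) (ha : ∀ Φ Ψ, p Φ → p Ψ → p (Φ + Ψ)) (Φ : SecForms Ξ) : p Φ := by
  obtain ⟨t, rfl⟩ : ∃ t, proj Ξ t = Φ := Submodule.mkQ_surjective (balance Ξ) Φ
  induction t using TensorProduct.induction_on with
  | zero => rw [map_zero]; exact h0
  | tmul T μ => exact ht T μ
  | add s t hs ht => rw [map_add]; exact ha _ _ hs ht

/-- A bilinear map `f` with `f (T · b) μ = f T (b μ)` as a map on `E_R ⊗_B Ω^•(B)`. -/
def secLift {M : Type*} [AddCommGroup M] [Module ℂ M]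
    (f : Sec Ξ →ₗ[ℂ] Forms (baseMat Ξ) →ₗ[ℂ] M)
    (hf : ∀ T b μ, f (MulOpposite.op b • T) μ = f T (ofAlg b * μ)) : SecForms Ξ →ₗ[ℂ] M :=
  (balance Ξ).liftQ (TensorProduct.lift f) (by
    rw [balance, Submodule.span_le]
    rintro _ ⟨T, b, μ, rfl⟩
    change _ = _
    rw [map_sub, TensorProduct.lift.tmul, TensorProduct.lift.tmul, hf, sub_self])

lemma secLift_tens {M : Type*} [AddCommGroup M] [Module ℂ M]
    (f : Sec Ξ →ₗ[ℂ] Forms (baseMat Ξ) →ₗ[ℂ] M)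
    (hf : ∀ T b μ, f (MulOpposite.op b • T) μ = f T (ofAlg b * μ)) (T : Sec Ξ)
    (μ : Forms (baseMat Ξ)) : secLift f hf (tens T μ) = f T μ := rfl

/-- The right multiplication by forms, `(T ⊗_B μ) · ν = T ⊗_B μ ν`. -/
def fmul (ν : Forms (baseMat Ξ)) : SecForms Ξ →ₗ[ℂ] SecForms Ξ :=
  secLift (tensL.compl₂ (LinearMap.mulRight ℂ ν)) (fun T b μ => by
    simp only [LinearMap.compl₂_apply, LinearMap.mulRight_apply, tensL_apply, tens_smul_left,
      mul_assoc])

lemma fmul_tens (ν : Forms (baseMat Ξ)) (T : Sec Ξ) (μ : Forms (baseMat Ξ)) :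
    fmul ν (tens T μ) = tens T (μ * ν) := rfl

instance : Module (Forms (baseMat Ξ))ᵐᵒᵖ (SecForms Ξ) where
  smul ν Φ := fmul ν.unop Φ
  one_smul Φ := by
    change fmul 1 Φ = Φ
    induction Φ using secForms_induction with
    | h0 => simp
    | ht T μ => rw [fmul_tens, mul_one]
    | ha Φ Ψ h1 h2 => rw [map_add, h1, h2]
  mul_smul a b Φ := by
    change fmul (b.unop * a.unop) Φ = fmul a.unop (fmul b.unop Φ)
    induction Φ using secForms_induction with
    | h0 => simp
    | ht T μ => rw [fmul_tens, fmul_tens, fmul_tens, mul_assoc]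
    | ha Φ Ψ h1 h2 => rw [map_add, map_add, map_add, h1, h2]
  smul_zero b := map_zero _
  smul_add b Φ Ψ := map_add _ _ _
  add_smul a b Φ := by
    change fmul (a.unop + b.unop) Φ = fmul a.unop Φ + fmul b.unop Φ
    induction Φ using secForms_induction with
    | h0 => simp
    | ht T μ =>
      rw [fmul_tens, fmul_tens, fmul_tens, mul_add, ← tensL_apply, map_add]; rfl
    | ha Φ Ψ h1 h2 => rw [map_add, map_add, map_add, h1, h2]; abel
  zero_smul Φ := by
    change fmul 0 Φ = 0
    induction Φ using secForms_induction with
    | h0 => simp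
    | ht T μ => rw [fmul_tens, mul_zero, ← tensL_apply, map_zero]
    | ha Φ Ψ h1 h2 => rw [map_add, h1, h2, add_zero]

lemma smul_tens (ν : Forms (baseMat Ξ)) (T : Sec Ξ) (μ : Forms (baseMat Ξ)) :
    MulOpposite.op ν • tens T μ = tens T (μ * ν) := rfl

instance : SMulCommClass (Forms (baseMat Ξ))ᵐᵒᵖ ℂ (SecForms Ξ) :=
  ⟨fun ν c Φ => map_smul (fmul ν.unop) c Φ⟩

lemma fmul_apply (ν : Forms (baseMat Ξ)) (Φ : SecForms Ξ) :
    fmul ν Φ = MulOpposite.op ν • Φ := rfl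

/-- The right multiplication by forms as a bilinear map. -/
def fmulL : SecForms Ξ →ₗ[ℂ] Forms (baseMat Ξ) →ₗ[ℂ] SecForms Ξ :=
  LinearMap.flip
    { toFun := fmul
      map_add' := fun a b => by ext1 Φ; exact add_smul (MulOpposite.op a) (MulOpposite.op b) Φ
      map_smul' := fun c a => by
        refine LinearMap.ext fun Φ => ?_
        change fmul (c • a) Φ = c • fmul a Φ
        induction Φ using secForms_induction with
        | h0 => simp
        | ht T μ => rw [fmul_tens, fmul_tens, mul_smul_comm, ← tensL_apply, map_smul]; rfl
        | ha Φ Ψ h1 h2 => rw [map_add, map_add, h1, h2, smul_add] }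

lemma fmulL_apply (Φ : SecForms Ξ) (ν : Forms (baseMat Ξ)) :
    fmulL Φ ν = MulOpposite.op ν • Φ := rfl

/-- The subspace `E_R ⊗_B Ω^k(B)`. -/
def secDeg (Ξ : Matrix (Fin (n + 1)) (Fin (n + 1)) ℝ) (k : ℕ) : Submodule ℂ (SecForms Ξ) :=
  Submodule.span ℂ {Φ | ∃ (T : Sec Ξ), ∃ μ ∈ deg (baseMat Ξ) k, Φ = tens T μ}

lemma smul_mem_secDeg {k l : ℕ} {Φ : SecForms Ξ} (hΦ : Φ ∈ secDeg Ξ k)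
    {ν : Forms (baseMat Ξ)} (hν : ν ∈ deg (baseMat Ξ) l) :
    MulOpposite.op ν • Φ ∈ secDeg Ξ (k + l) := by
  rw [← fmul_apply]
  induction hΦ using Submodule.span_induction with
  | mem Φ h =>
    obtain ⟨T, μ, hμ, rfl⟩ := h
    exact Submodule.subset_span ⟨T, μ * ν, mul_mem_deg hμ hν, rfl⟩
  | zero => rw [map_zero]; exact zero_mem _
  | add Φ Ψ _ _ h1 h2 => rw [map_add]; exact add_mem h1 h2
  | smul c Φ _ h => rw [map_smul]; exact Submodule.smul_mem _ _ h

/-- The right `B`-linear maps `E_R → E_R ⊗_B Ω^k(B)`. -/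
def Hom (Ξ : Matrix (Fin (n + 1)) (Fin (n + 1)) ℝ) (k : ℕ) :
    Submodule ℂ (Sec Ξ →ₗ[ℂ] SecForms Ξ) where
  carrier := {Λ | (∀ T, Λ T ∈ secDeg Ξ k) ∧
    ∀ (T : Sec Ξ) (b : Base Ξ),
      Λ (MulOpposite.op b • T) = MulOpposite.op (ofAlg b : Forms (baseMat Ξ)) • Λ T}
  add_mem' {Λ Λ'} h h' := ⟨fun T => add_mem (h.1 T) (h'.1 T), fun T b => by
    rw [LinearMap.add_apply, LinearMap.add_apply, h.2, h'.2, smul_add]⟩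
  zero_mem' := ⟨fun T => zero_mem _, fun T b => by simp⟩
  smul_mem' c Λ h := ⟨fun T => Submodule.smul_mem _ _ (h.1 T), fun T b => by
    rw [LinearMap.smul_apply, LinearMap.smul_apply, h.2, ← fmul_apply, ← fmul_apply, map_smul]⟩

/-- Quantum linear connections on `E_R`. -/
structure QLC (Ξ : Matrix (Fin (n + 1)) (Fin (n + 1)) ℝ) where
  /-- the covariant derivative -/
  toFun : Sec Ξ →ₗ[ℂ] SecForms Ξ
  mem_deg : ∀ T, toFun T ∈ secDeg Ξ 1
  leibniz : ∀ (T : Sec Ξ) (b : Base Ξ), toFun (MulOpposite.op b • T)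
    = MulOpposite.op (ofAlg b : Forms (baseMat Ξ)) • toFun T + tens T (d (ofAlg b))

/-- The extension `Λ^ext(T ⊗_B μ) = Λ(T) μ`. -/
def homExt {k : ℕ} (Λ : Hom Ξ k) : SecForms Ξ →ₗ[ℂ] SecForms Ξ :=
  secLift (fmulL.comp Λ.1) (fun T b μ => by
    simp only [LinearMap.comp_apply, fmulL_apply, Λ.2.2, smul_smul, ← MulOpposite.op_mul])

lemma homExt_tens {k : ℕ} (Λ : Hom Ξ k) (T : Sec Ξ) (μ : Forms (baseMat Ξ)) :
    homExt Λ (tens T μ) = MulOpposite.op μ • Λ.1 T := rfl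

lemma homExt_mem {k l : ℕ} (Λ : Hom Ξ k) {Φ : SecForms Ξ} (hΦ : Φ ∈ secDeg Ξ l) :
    homExt Λ Φ ∈ secDeg Ξ (k + l) := by
  induction hΦ using Submodule.span_induction with
  | mem Φ h =>
    obtain ⟨T, μ, hμ, rfl⟩ := h
    rw [homExt_tens]
    exact smul_mem_secDeg (Λ.2.1 T) hμ
  | zero => rw [map_zero]; exact zero_mem _
  | add Φ Ψ _ _ h1 h2 => rw [map_add]; exact add_mem h1 h2
  | smul c Φ _ h => rw [map_smul]; exact Submodule.smul_mem _ _ h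

lemma homExt_smul {k : ℕ} (Λ : Hom Ξ k) (ν : Forms (baseMat Ξ)) (Φ : SecForms Ξ) :
    homExt Λ (MulOpposite.op ν • Φ) = MulOpposite.op ν • homExt Λ Φ := by
  induction Φ using secForms_induction with
  | h0 => rw [smul_zero, map_zero, smul_zero]
  | ht T μ => rw [smul_tens, homExt_tens, homExt_tens, MulOpposite.op_mul, mul_smul]
  | ha Φ Ψ h1 h2 => rw [smul_add, map_add, map_add, h1, h2, smul_add]

namespace QLC

variable (D : QLC Ξ)

/-- The exterior covariant derivative `d^∇(T ⊗_B μ) = ∇(T) μ + T ⊗_B dμ`. -/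
def extD : SecForms Ξ →ₗ[ℂ] SecForms Ξ :=
  secLift (fmulL.comp D.toFun + tensL.compl₂ d) (fun T b μ => by
    simp only [LinearMap.add_apply, LinearMap.comp_apply, fmulL_apply, LinearMap.compl₂_apply,
      tensL_apply, D.leibniz, tens_smul_left, smul_add, smul_smul, ← MulOpposite.op_mul, smul_tens]
    rw [d_ofAlg_mul, ← tensL_apply T (d _ * μ + _), map_add, tensL_apply, tensL_apply, add_assoc])

lemma extD_tens (T : Sec Ξ) (μ : Forms (baseMat Ξ)) :
    D.extD (tens T μ) = MulOpposite.op μ • D.toFun T + tens T (d μ) := rfl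

lemma extD_mem {k : ℕ} {Φ : SecForms Ξ} (hΦ : Φ ∈ secDeg Ξ k) : D.extD Φ ∈ secDeg Ξ (k + 1) := by
  induction hΦ using Submodule.span_induction with
  | mem Φ h =>
    obtain ⟨T, μ, hμ, rfl⟩ := h
    rw [extD_tens]
    refine add_mem ?_ (Submodule.subset_span ⟨T, d μ, d_mem_deg hμ, rfl⟩)
    rw [add_comm]
    exact smul_mem_secDeg (D.mem_deg T) hμ
  | zero => rw [map_zero]; exact zero_mem _
  | add Φ Ψ _ _ h1 h2 => rw [map_add]; exact add_mem h1 h2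
  | smul c Φ _ h => rw [map_smul]; exact Submodule.smul_mem _ _ h

lemma extD_smul {k : ℕ} {Φ : SecForms Ξ} (hΦ : Φ ∈ secDeg Ξ k) (b : Base Ξ) :
    D.extD (MulOpposite.op (ofAlg b : Forms (baseMat Ξ)) • Φ)
      = MulOpposite.op (ofAlg b : Forms (baseMat Ξ)) • D.extD Φ
        + (-1 : ℂ) ^ k • MulOpposite.op (d (ofAlg b) : Forms (baseMat Ξ)) • Φ := by
  simp only [← fmul_apply]
  induction hΦ using Submodule.span_induction with
  | mem Φ h =>
    obtain ⟨T, μ, hμ, rfl⟩ := h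
    rw [fmul_tens, fmul_tens, extD_tens, extD_tens, map_add, fmul_tens, fmul_apply, smul_smul,
      ← MulOpposite.op_mul, d_mul_ofAlg hμ, ← tensL_apply T (_ + _), map_add, map_smul,
      tensL_apply, tensL_apply, add_assoc]
  | zero => simp
  | add Φ Ψ _ _ h1 h2 => simp only [map_add, h1, h2, smul_add]; abel
  | smul c Φ _ h =>
    simp only [map_smul, h, smul_add]
    rw [smul_comm]

/-- The curvature `R^∇ = d^∇ ∘ ∇`. -/
def curv : Hom Ξ 2 :=
  ⟨D.extD.comp D.toFun, fun T => D.extD_mem (D.mem_deg T), fun T b => by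
    rw [LinearMap.comp_apply, LinearMap.comp_apply, D.leibniz, map_add,
      D.extD_smul (D.mem_deg T), extD_tens, d_d, ← tensL_apply T 0, map_zero, add_zero,
      pow_one, neg_one_smul, neg_add_cancel_right]⟩

/-- The commutator `[∇, Λ] = d^∇ ∘ Λ - (-1)^k Λ^ext ∘ ∇` for `Λ : E_R → E_R ⊗_B Ω^k(B)`. -/
def comm {k : ℕ} (Λ : Hom Ξ k) : Hom Ξ (k + 1) :=
  ⟨D.extD.comp Λ.1 - (-1 : ℂ) ^ k • (homExt Λ).comp D.toFun,
    fun T => sub_mem (D.extD_mem (Λ.2.1 T))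
      (Submodule.smul_mem _ _ (homExt_mem Λ (D.mem_deg T))),
    fun T b => by
      simp only [LinearMap.sub_apply, LinearMap.smul_apply, LinearMap.comp_apply, Λ.2.2,
        D.extD_smul (Λ.2.1 T), D.leibniz, map_add, homExt_smul, homExt_tens, smul_add, smul_sub]
      rw [smul_comm (MulOpposite.op (ofAlg b : Forms (baseMat Ξ))) ((-1 : ℂ) ^ k)]
      abel⟩

end QLC

/-! ## The canonical metric and the Yang-Mills condition -/

/-- The element `T(ϑ)` of `B`. -/
def secCoord : Sec Ξ →ₗ[ℂ] Base Ξ := res.comp ((LinearMap.applyₗ theta).comp Sec.val)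

lemma incl_secCoord (T : Sec Ξ) : incl (secCoord T) = Sec.val T theta :=
  (incl_res _).trans ((mem_MorAd_iff (Sec.val T)).1 T.2 theta)

lemma secCoord_smul (b : Base Ξ) (T : Sec Ξ) :
    secCoord (MulOpposite.op b • T) = secCoord T * b :=
  res_mul_incl _ _

/-- The canonical Hermitian structure `⟨T₁, T₂⟩ = T₁(ϑ)^* T₂(ϑ) ∈ B`. -/
def herm (T₁ T₂ : Sec Ξ) : Base Ξ := res (star (Sec.val T₁ theta) * Sec.val T₂ theta)

lemma incl_herm (T₁ T₂ : Sec Ξ) :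
    incl (herm T₁ T₂) = star (Sec.val T₁ theta) * Sec.val T₂ theta := by
  rw [herm, ← incl_secCoord T₁, ← incl_secCoord T₂, ← incl_star, ← map_mul, res_incl]

lemma herm_eq (T₁ T₂ : Sec Ξ) : herm T₁ T₂ = star (secCoord T₁) * secCoord T₂ := by
  rw [herm, ← incl_secCoord T₁, ← incl_secCoord T₂, ← incl_star, ← map_mul, res_incl]

/-- The form `T(ϑ) μ` in `Ω^•(B)`, for `T ⊗_B μ` in `E_R ⊗_B Ω^•(B)`. -/
def evalForm : SecForms Ξ →ₗ[ℂ] Forms (baseMat Ξ) :=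
  secLift ((LinearMap.mul ℂ (Forms (baseMat Ξ))).comp (ofAlg.toLinearMap.comp secCoord))
    (fun T b μ => by
      change ofAlg (secCoord _) * μ = ofAlg (secCoord T) * (ofAlg b * μ)
      rw [secCoord_smul, map_mul, mul_assoc])

lemma evalForm_tens (T : Sec Ξ) (μ : Forms (baseMat Ξ)) :
    evalForm (tens T μ) = ofAlg (secCoord T) * μ := rfl

/-- The extension of the Hermitian structure to section-valued forms,
`⟨T₁ ⊗ μ₁, T₂ ⊗ μ₂⟩ = μ₁^* ⟨T₁, T₂⟩ μ₂`; see `hermForm_tens`. -/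
def hermForm (Φ Ψ : SecForms Ξ) : Forms (baseMat Ξ) := starF (evalForm Φ) * evalForm Ψ

lemma hermForm_tens (T₁ T₂ : Sec Ξ) (μ₁ μ₂ : Forms (baseMat Ξ)) :
    hermForm (tens T₁ μ₁) (tens T₂ μ₂) = starF μ₁ * ofAlg (herm T₁ T₂) * μ₂ := by
  rw [hermForm, evalForm_tens, evalForm_tens, starF_ofAlg_mul, herm_eq, map_mul]
  simp only [mul_assoc]

/-- A connection is compatible with the metric if
`⟨T₁, ∇T₂⟩ - ⟨∇T₁, T₂⟩ = d⟨T₁, T₂⟩`. -/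
def QLC.IsCompatible (D : QLC Ξ) : Prop :=
  ∀ T₁ T₂ : Sec Ξ, hermForm (tens T₁ 1) (D.toFun T₂) - hermForm (D.toFun T₁) (tens T₂ 1)
    = d (ofAlg (herm T₁ T₂))

/-- The inner product of section-valued forms,
`⟨T₁ ⊗ μ₁ | T₂ ⊗ μ₂⟩ = ⟨μ₁ | ⟨T₁, T₂⟩ μ₂⟩`; see `ipSec_tens`. -/
def ipSec (Φ Ψ : SecForms Ξ) : ℂ := ip (evalForm Φ) (evalForm Ψ)

lemma ipSec_tens (T₁ T₂ : Sec Ξ) (μ₁ μ₂ : Forms (baseMat Ξ)) :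
    ipSec (tens T₁ μ₁) (tens T₂ μ₂) = ip μ₁ (ofAlg (herm T₁ T₂) * μ₂) := by
  rw [ipSec, evalForm_tens, evalForm_tens, ip, ip, starF_ofAlg_mul, herm_eq, map_mul ofAlg,
    hodgeQ_ofAlg_mul, mul_assoc (ofAlg _) (ofAlg _), hodgeQ_ofAlg_mul, hodgeQ_ofAlg_mul, mul_assoc]

/-- The inner product `⟪Λ₁ | Λ₂⟫ = ⟨Λ₁(T^triv) | Λ₂(T^triv)⟩` of right `B`-linear maps; the module
`E_R` is generated by `T^triv`. -/
def ipHom {k : ℕ} (Λ₁ Λ₂ : Hom Ξ k) : ℂ := ipSec (Λ₁.1 (secTriv Ξ)) (Λ₂.1 (secTriv Ξ))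

/-- The connection `∇` is a Yang-Mills connection if `[∇, -]`, from the right `B`-linear maps with
values in `E_R ⊗_B Ω¹(B)` to those with values in `E_R ⊗_B Ω²(B)`, has a formal adjoint `[∇, -]^⋆`
and `[∇, -]^⋆ R^∇ = 0`. -/
def QLC.IsYangMills (D : QLC Ξ) : Prop :=
  ∃ A : Hom Ξ 2 →ₗ[ℂ] Hom Ξ 1,
    (∀ (Λ : Hom Ξ 1) (Φ : Hom Ξ 2), ipHom (D.comm Λ) Φ = ipHom Λ (A Φ)) ∧ A D.curv = 0

/-! ## Quantum principal connections and their gauge connections -/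

/-- The contraction of a form on `P` with the dual of `dU_{n+1}`, from the right. -/
def contr : Forms Ξ →ₗ[ℂ] Forms Ξ :=
  (TensorProduct.AlgebraTensorModule.map LinearMap.id
    ((CliffordAlgebra.contractRight (R := ℝ) (M := Fin (n + 1) → ℝ) (Q := 0)).flip
      (LinearMap.proj (Fin.last n))) :
    QTorus Ξ ⊗[ℝ] Ext (n + 1) →ₗ[ℂ] QTorus Ξ ⊗[ℝ] Ext (n + 1))

/-- The part of degree `k` in `u_{n+1}` of a form on `P`. -/
def wtForm (k : ℤ) : Forms Ξ →ₗ[ℂ] Forms Ξ :=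
  (TensorProduct.AlgebraTensorModule.map (wt k) LinearMap.id :
    QTorus Ξ ⊗[ℝ] Ext (n + 1) →ₗ[ℂ] QTorus Ξ ⊗[ℝ] Ext (n + 1))

/-- The coaction `Δ_Ω : Ω^•(P) → Ω^•(P) ⊗ Γ^∧` with `dU_j ↦ dU_j ⊗ 1` for `j ≤ n` and
`dU_{n+1} ↦ dU_{n+1} ⊗ 1 - (1/2π) 1 ⊗ ϑ`, that is, `du_{n+1} ↦ du_{n+1} ⊗ z + u_{n+1} ⊗ dz`. Here
`Γ^∧ = G ⊕ G ϑ`; the two components of the value are recorded as formal Laurent series in `z`, with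
`z^k` and `z^k ϑ`, respectively, at the index `k`. -/
def coactForm : Forms Ξ →ₗ[ℂ] (ℤ → Forms Ξ) × (ℤ → Forms Ξ ⊗[ℂ] U1Dual) :=
  (LinearMap.pi wtForm).prod
    (LinearMap.pi fun k =>
      (TensorProduct.mk ℂ (Forms Ξ) U1Dual).flip ((-(1 / (2 * Real.pi)) : ℂ) • theta)
        ∘ₗ contr ∘ₗ wtForm k)

/-- Quantum principal connections: `Δ_Ω(ω(θ)) = (ω ⊗ id) ad(θ) + 1 ⊗ θ` and `ω(θ^*) = ω(θ)^*`,
where `π(g)^* = π(S(g)^*)`. -/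
structure QPC (Ξ : Matrix (Fin (n + 1)) (Fin (n + 1)) ℝ) where
  /-- the connection form -/
  toFun : U1Dual →ₗ[ℂ] Forms Ξ
  mem_deg : ∀ θ, toFun θ ∈ deg Ξ 1
  coact : ∀ θ, coactForm (toFun θ)
    = (toFormal (Forms Ξ) (toFun.rTensor G (ad θ)), Pi.single (0 : ℤ) ((1 : Forms Ξ) ⊗ₜ[ℂ] θ))
  star : ∀ g : G, toFun (germ (starG (HopfAlgebra.antipode ℂ g))) = starF (toFun (germ g))

/-- The operator `D̂^ω(T)(θ) = d(T(θ)) + ω(π(S⁻¹(θ^{(1)}))) T(θ^{(0)})` with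
`ad θ = θ^{(0)} ⊗ θ^{(1)}`; the antipode of `G` is involutive. -/
def covD (ω : QPC Ξ) (T : Sec Ξ) : U1Dual →ₗ[ℂ] Forms Ξ :=
  d ∘ₗ ofAlg.toLinearMap ∘ₗ Sec.val T
    + TensorProduct.lift
        ((LinearMap.mul ℂ (Forms Ξ)).flip.compl₁₂ (ofAlg.toLinearMap ∘ₗ Sec.val T)
          (ω.toFun ∘ₗ germ ∘ₗ HopfAlgebra.antipode ℂ)) ∘ₗ ad

/-- The inverse on `Ω^•(B) ⊆ Ω^•(P)` of the inclusion. -/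
def resForm : Forms Ξ →ₗ[ℂ] Forms (baseMat Ξ) :=
  (TensorProduct.AlgebraTensorModule.map res
    (ExteriorAlgebra.map (LinearMap.funLeft ℝ ℝ Fin.castSucc)).toLinearMap :
    QTorus Ξ ⊗[ℝ] Ext (n + 1) →ₗ[ℂ] QTorus (baseMat Ξ) ⊗[ℝ] Ext n)

/-- The gauge connection of `ω`, `∇^ω(T) = T^triv ⊗_B D̂^ω(T)(ϑ)`. -/
def gaugeConn (ω : QPC Ξ) (T : Sec Ξ) : SecForms Ξ :=
  tens (secTriv Ξ) (resForm (covD ω T theta))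

end Main

end QTor

end

open QTor

noncomputable section

namespace QTor

/-! ## The exterior algebra and its Hodge operator -/

section Exterior

variable {n : ℕ}

/-! The bundle is trivial, so the statement reduces to a computation with forms on the base. The
adjoint coaction is trivial, so in the gauge connection `ω` is evaluated only at `π(1) = 0`; hence
the gauge connection kills `T^triv` (`gaugeConn_secTriv`), and `∇(T^triv) = T^triv ⊗ μ`. As `T^triv`
freely generates `E_R`, evaluation at `T^triv` turns a right `B`-linear map `Λ` into a form `λ`.
Under this identification the curvature is `dμ + μμ` (`homForm_curv`), the commutator `[∇, Λ]` is
`dλ + μλ + λμ` (`homForm_comm`), and metric compatibility says `μ^* = μ`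
(`QLC.starF_eq_of_isCompatible`).

The formal adjoint is then found by integration by parts (`ip_covariant_derivative`). For one-forms,
`(dλ)^* = -d(λ^*)`, `(μλ)^* = -λ^* μ` and `(λμ)^* = -μ λ^*`. Stokes' formula `∫ d = 0` moves `d`
from `λ^*` to `⋆φ`, and the graded cyclicity of `∫` carries `μ` from the far left to the far right
at the cost of `(-1)^(n-1)`. Therefore `⟨dλ + μλ + λμ | φ⟩ = -∫ λ^* (d⋆φ + μ ⋆φ + (-1)^(n-1) ⋆φ μ)`.

The bracket is `ymForm μ φ`. Since `⋆` is invertible, `φ ↦ -⋆⁻¹ (ymForm μ φ)` is a formal adjoint,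
so existence is automatic. Since the inner product is nondegenerate in each degree
(`eq_zero_of_ip_eq_zero`, from faithfulness of the trace), any formal adjoint kills the curvature
exactly when `ymForm μ (dμ + μμ) = 0`. -/

lemma basisExt_mem {k : ℕ} {s : Finset (Fin n)} (hs : s.card = k) :
    basisExt n s ∈ (⋀[ℝ]^k (Fin n → ℝ) : Submodule ℝ (Ext n)) := by
  rw [basisExt, ExteriorAlgebra.basis_apply_ofCard _ hs]
  exact ExteriorAlgebra.ιMulti_range ℝ k ⟨_, rfl⟩

/-- Lets degree statements about operators defined on the basis `e_s`, such as the Hodge star, be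
checked on basis vectors. -/
lemma exteriorPower_le_span (n k : ℕ) : (⋀[ℝ]^k (Fin n → ℝ) : Submodule ℝ (Ext n))
    ≤ Submodule.span ℝ {v | ∃ s : Finset (Fin n), s.card = k ∧ v = basisExt n s} := by
  rw [← exteriorPower.ιMulti_family_span_fixedDegree_of_span ℝ (Pi.basisFun ℝ (Fin n)).span_eq]
  refine Submodule.span_mono ?_
  rintro _ ⟨s, rfl⟩
  exact ⟨s.1, s.2, (ExteriorAlgebra.basis_apply_powersetCard _ s).symm⟩

/-- The sign `σ` with `e_s ∧ e_{sᶜ} = σ e₁ ∧ ⋯ ∧ eₙ`. -/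
def complSign (s : Finset (Fin n)) : ℝ :=
  (basisExt n).coord Finset.univ (basisExt n s * basisExt n sᶜ)

lemma hodge_basisExt (s : Finset (Fin n)) :
    hodge n (basisExt n s) = complSign s • basisExt n sᶜ :=
  (basisExt n).constr_basis ℝ _ s

/-- For disjoint index sets the product of basis vectors is a permutation sign times the basis
vector of the union, here all of `{1, …, n}`. Nonvanishing suffices both for inverting `⋆` and for
nondegeneracy of the inner product. -/
lemma complSign_ne_zero (s : Finset (Fin n)) : complSign s ≠ 0 := by
  let s' : Set.powersetCard (Fin n) s.card := ⟨s, rfl⟩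
  let t' : Set.powersetCard (Fin n) sᶜ.card := ⟨sᶜ, rfl⟩
  have hd : Disjoint s'.val t'.val := disjoint_compl_right
  have h := ExteriorAlgebra.basis_mul_of_disjoint (Pi.basisFun ℝ (Fin n)) s' t' hd
  have hu : (Set.powersetCard.disjUnion hd : Finset (Fin n)) = Finset.univ := by
    rw [Set.powersetCard.coe_disjUnion, Finset.disjUnion_eq_union]
    exact Finset.union_compl s
  rw [hu] at h
  change basisExt n s * basisExt n sᶜ = _ • basisExt n Finset.univ at h
  have h1 : (basisExt n).coord Finset.univ (basisExt n Finset.univ) = 1 := by simp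
  rw [complSign, h, Units.smul_def, map_zsmul, h1]
  simp

lemma basisExt_mul_of_not_disjoint {s t : Finset (Fin n)} (h : ¬Disjoint s t) :
    basisExt n s * basisExt n t = 0 :=
  ExteriorAlgebra.basis_mul_of_not_disjoint (Pi.basisFun ℝ (Fin n))
    (⟨s, rfl⟩ : Set.powersetCard (Fin n) s.card) (⟨t, rfl⟩ : Set.powersetCard (Fin n) t.card) h

/-- The inverse of the Hodge star operator. -/
def hodgeInv (n : ℕ) : Ext n →ₗ[ℝ] Ext n :=
  (basisExt n).constr ℝ fun s => (complSign sᶜ)⁻¹ • basisExt n sᶜ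

lemma hodgeInv_basisExt (s : Finset (Fin n)) :
    hodgeInv n (basisExt n s) = (complSign sᶜ)⁻¹ • basisExt n sᶜ :=
  (basisExt n).constr_basis ℝ _ s

/-- The inverse sends `e_s` to a multiple of `e_{sᶜ}`, on which `⋆` produces the sign of `sᶜ` rather
than that of `s`; this explains the coefficient in `hodgeInv`. -/
lemma hodge_hodgeInv (v : Ext n) : hodge n (hodgeInv n v) = v := by
  have h : (hodge n).comp (hodgeInv n) = LinearMap.id := (basisExt n).ext fun s => by
    rw [LinearMap.comp_apply, hodgeInv_basisExt, map_smul, hodge_basisExt, smul_smul,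
      inv_mul_cancel₀ (complSign_ne_zero _), one_smul, compl_compl, LinearMap.id_apply]
  exact LinearMap.congr_fun h v

/-- The coefficients `c` are left arbitrary so that the lemma covers both `hodge` and `hodgeInv`. -/
lemma map_mem_exteriorPower_compl {f : Ext n →ₗ[ℝ] Ext n} {c : Finset (Fin n) → ℝ}
    (hf : ∀ s, f (basisExt n s) = c s • basisExt n sᶜ) {k l : ℕ} (hkl : k + l = n) {v : Ext n}
    (hv : v ∈ (⋀[ℝ]^k (Fin n → ℝ) : Submodule ℝ (Ext n))) :
    f v ∈ (⋀[ℝ]^l (Fin n → ℝ) : Submodule ℝ (Ext n)) := by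
  have h : Submodule.span ℝ {v | ∃ s : Finset (Fin n), s.card = k ∧ v = basisExt n s}
      ≤ (⋀[ℝ]^l (Fin n → ℝ) : Submodule ℝ (Ext n)).comap f := by
    rw [Submodule.span_le]
    rintro _ ⟨s, hs, rfl⟩
    rw [SetLike.mem_coe, Submodule.mem_comap, hf]
    refine Submodule.smul_mem _ _ (basisExt_mem ?_)
    rw [Finset.card_compl, Fintype.card_fin]
    omega
  exact h (exteriorPower_le_span n k hv)

lemma mul_comm_of_mem_one {k : ℕ} {v w : Ext n}
    (hv : v ∈ (⋀[ℝ]^k (Fin n → ℝ) : Submodule ℝ (Ext n)))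
    (hw : w ∈ (⋀[ℝ]^1 (Fin n → ℝ) : Submodule ℝ (Ext n))) :
    w * v = (-1 : ℝ) ^ k • (v * w) := by
  have hw' : w ∈ LinearMap.range (ExteriorAlgebra.ι ℝ (M := Fin n → ℝ)) := by
    unfold ExteriorAlgebra.exteriorPower at hw
    rwa [pow_one] at hw
  obtain ⟨m, rfl⟩ := hw'
  have hm : ExteriorAlgebra.ι ℝ m = ∑ j, m j • gen j := by
    conv_lhs => rw [← (Pi.basisFun ℝ (Fin n)).sum_repr m]
    simp [gen]
  have h1 : (-1 : ℝ) ^ k * (-1 : ℝ) ^ k = 1 := by rw [← mul_pow]; simp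
  rw [hm, Finset.sum_mul, Finset.mul_sum, Finset.smul_sum]
  refine Finset.sum_congr rfl fun j _ => ?_
  rw [mul_smul_comm, mul_gen hv, smul_comm (m j), smul_smul, h1, one_smul, smul_mul_assoc]

end Exterior

/-! ## The trace of the quantum torus -/

namespace QTorus

variable {n : ℕ} {Ξ : Matrix (Fin n) (Fin n) ℝ}

lemma trace_apply (x : QTorus Ξ) : trace x = x.coeff 0 := rfl

/-- In the constant coefficient only the pairs `(l, -l)` contribute, and there the phase is
symmetric, since `ordForm` is bilinear. -/
lemma trace_mul_comm (x y : QTorus Ξ) : trace (x * y) = trace (y * x) := by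
  rw [trace_apply, trace_apply, coeff_mul, coeff_mul, ← (Equiv.neg (Fin n → ℤ)).tsum_eq]
  refine tsum_congr fun l => ?_
  have h : phase Ξ (-l) l = phase Ξ l (-l) := by
    simp only [phase, ordForm_neg_left, ordForm_neg_right]
  simp only [Equiv.neg_apply, zero_sub, neg_neg, h]
  ring

lemma trace_delta (j : Fin n) (x : QTorus Ξ) : trace (delta j x) = 0 := by
  rw [trace_apply, coeff_delta]
  simp

/-- Conjugating `2πi m_j` gives one sign and replacing `m` by `-m` another; they cancel. -/
lemma star_delta (j : Fin n) (x : QTorus Ξ) : star (delta j x) = delta j (star x) := by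
  ext m
  rw [coeff_star, coeff_delta, coeff_delta, coeff_star]
  simp only [map_mul, Complex.conj_I, Complex.conj_ofReal, map_ofNat, map_intCast, Pi.neg_apply]
  push_cast
  ring

/-- Parseval's identity: the phase in the product and the phase in the `*`-operation are inverse to
each other. -/
lemma trace_star_mul_self (x : QTorus Ξ) :
    trace (star x * x) = ((∑' l, ‖x.coeff l‖ ^ 2 : ℝ) : ℂ) := by
  rw [trace_apply, coeff_mul, Complex.ofReal_tsum, ← (Equiv.neg (Fin n → ℤ)).tsum_eq]
  refine tsum_congr fun l => ?_
  have h : phase Ξ (-l) l * phase Ξ (-l) (-l) = 1 := by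
    simp only [phase, ← Complex.exp_add, ordForm_neg_left, ordForm_neg_right]
    rw [Complex.exp_eq_one_iff]
    exact ⟨0, by push_cast; ring⟩
  simp only [Equiv.neg_apply, zero_sub, neg_neg, coeff_star]
  rw [← mul_assoc, h, one_mul, Complex.conj_mul']
  push_cast
  rfl

lemma eq_zero_of_trace_star_mul_self {x : QTorus Ξ} (h : trace (star x * x) = 0) : x = 0 := by
  rw [trace_star_mul_self, Complex.ofReal_eq_zero] at h
  -- Summability is essential: a divergent `tsum` is zero by default and would carry no information
  -- about the coefficients.
  have hs : Summable fun l => ‖x.coeff l‖ ^ 2 := by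
    obtain ⟨C, hC0, hC⟩ := x.bounded
    refine Summable.of_nonneg_of_le (fun l => by positivity) (fun l => ?_)
      (x.summable_norm.mul_left C)
    rw [sq]
    exact mul_le_mul_of_nonneg_right (hC l) (norm_nonneg _)
  have h0 := (hs.hasSum_iff.2 h)
  rw [hasSum_zero_iff_of_nonneg fun l => by positivity] at h0
  ext l
  simpa using congrFun h0 l

end QTorus

/-! ## Calculus of differential forms -/

section FormCalculus

variable {n : ℕ} {Ξ : Matrix (Fin n) (Fin n) ℝ}

/-- The inverse of the quantum Hodge operator. -/
def hodgeInvQ : Forms Ξ →ₗ[ℂ] Forms Ξ :=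
  (TensorProduct.AlgebraTensorModule.map LinearMap.id (hodgeInv n) :
    QTorus Ξ ⊗[ℝ] Ext n →ₗ[ℂ] QTorus Ξ ⊗[ℝ] Ext n)

lemma hodgeInvQ_form (x : QTorus Ξ) (v : Ext n) :
    hodgeInvQ (form x v) = form x (hodgeInv n v) := rfl

lemma hodgeQ_hodgeInvQ (φ : Forms Ξ) : hodgeQ (hodgeInvQ φ) = φ := by
  induction φ using form_induction with
  | h0 => simp
  | ha φ ψ h1 h2 => simp only [map_add, h1, h2]
  | hf x v => rw [hodgeInvQ_form, hodgeQ_form, hodge_hodgeInv]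

lemma map_mem_deg {f : Forms Ξ →ₗ[ℂ] Forms Ξ} {k l : ℕ}
    (hf : ∀ x, ∀ v ∈ (⋀[ℝ]^k (Fin n → ℝ) : Submodule ℝ (Ext n)), f (form x v) ∈ deg Ξ l)
    {φ : Forms Ξ} (hφ : φ ∈ deg Ξ k) : f φ ∈ deg Ξ l := by
  have h : deg Ξ k ≤ (deg Ξ l).comap f := by
    rw [deg, Submodule.span_le]
    rintro _ ⟨x, v, hv, rfl⟩
    exact hf x v hv
  exact h hφ

lemma hodgeQ_mem_deg {k l : ℕ} (hkl : k + l = n) {φ : Forms Ξ} (hφ : φ ∈ deg Ξ k) :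
    hodgeQ φ ∈ deg Ξ l :=
  map_mem_deg (fun x _ hv =>
    form_mem_deg x (map_mem_exteriorPower_compl hodge_basisExt hkl hv)) hφ

lemma hodgeInvQ_mem_deg {k l : ℕ} (hkl : k + l = n) {φ : Forms Ξ} (hφ : φ ∈ deg Ξ k) :
    hodgeInvQ φ ∈ deg Ξ l :=
  map_mem_deg (fun x _ hv =>
    form_mem_deg x (map_mem_exteriorPower_compl hodgeInv_basisExt hkl hv)) hφ

/-! ### The `*`-operation, the graded Leibniz rule and the integral. -/

lemma starF_smul (c : ℂ) (φ : Forms Ξ) : starF (c • φ) = (starRingEnd ℂ) c • starF φ := by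
  induction φ using form_induction with
  | h0 => simp
  | ha φ ψ h1 h2 => simp only [smul_add, map_add, h1, h2]
  | hf x v => rw [← form_smul_left, starF_form, starF_form, star_smul, form_smul_left]; rfl

lemma starF_one : starF (1 : Forms Ξ) = 1 := by
  rw [← map_one (ofAlg (Ξ := Ξ)), ofAlg_apply, starF_form, star_one]

lemma starF_mem_deg {k : ℕ} {φ : Forms Ξ} (hφ : φ ∈ deg Ξ k) : starF φ ∈ deg Ξ k := by
  induction hφ using Submodule.span_induction with
  | mem φ h =>
    obtain ⟨x, v, hv, rfl⟩ := h
    exact form_mem_deg _ hv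
  | zero => rw [map_zero]; exact zero_mem _
  | add φ ψ _ _ h1 h2 => rw [map_add]; exact add_mem h1 h2
  | smul c φ _ h => rw [starF_smul]; exact Submodule.smul_mem _ _ h

/-- The sign is the conjugate of the factor `i` in `d`; the derivations `δ_j` commute with `*`, and
the real vectors `e_j` are fixed. -/
lemma starF_d (φ : Forms Ξ) : starF (d φ) = -d (starF φ) := by
  induction φ using form_induction with
  | h0 => simp
  | ha φ ψ h1 h2 => simp only [map_add, h1, h2]; abel
  | hf x v =>
    rw [starF_form, d_form, d_form, map_sum, ← Finset.sum_neg_distrib]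
    refine Finset.sum_congr rfl fun j _ => ?_
    rw [starF_form, star_smul, QTorus.star_delta, form_smul_left, form_smul_left, ← neg_smul]
    simp

/-- The `*`-operation reverses products in the quantum torus but not in the exterior algebra, so
restoring the order of two vectors of degree one costs a sign. -/
lemma starF_mul_of_mem_one {φ ψ : Forms Ξ} (hφ : φ ∈ deg Ξ 1) (hψ : ψ ∈ deg Ξ 1) :
    starF (φ * ψ) = -(starF ψ * starF φ) := by
  induction hφ using Submodule.span_induction with
  | mem φ h =>
    obtain ⟨x, v, hv, rfl⟩ := h
    induction hψ using Submodule.span_induction with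
    | mem ψ h =>
      obtain ⟨y, w, hw, rfl⟩ := h
      rw [form_mul, starF_form, starF_form, starF_form, form_mul, star_mul,
        mul_comm_of_mem_one hw hv, pow_one, neg_one_smul, form_neg_right]
    | zero => simp
    | add φ ψ _ _ h1 h2 => simp only [mul_add, add_mul, map_add, h1, h2]; abel
    | smul c φ _ h => simp only [mul_smul_comm, smul_mul_assoc, starF_smul, h, smul_neg]
  | zero => simp
  | add φ ψ _ _ h1 h2 => simp only [mul_add, add_mul, map_add, h1, h2]; abel
  | smul c φ _ h => simp only [mul_smul_comm, smul_mul_assoc, starF_smul, h, smul_neg]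

/-- The derivation rule for `δ_j` gives the two terms; in the second, `e_j` has to pass the `k`
vectors of the first factor. -/
lemma d_mul {k : ℕ} {φ : Forms Ξ} (hφ : φ ∈ deg Ξ k) (ψ : Forms Ξ) :
    d (φ * ψ) = d φ * ψ + (-1 : ℂ) ^ k • (φ * d ψ) := by
  induction hφ using Submodule.span_induction with
  | mem φ h =>
    obtain ⟨x, v, hv, rfl⟩ := h
    induction ψ using form_induction with
    | h0 => simp
    | ha φ ψ h1 h2 => simp only [mul_add, map_add, h1, h2, smul_add]; abel
    | hf y w =>
      simp only [form_mul, d_form, Finset.sum_mul, Finset.mul_sum, Finset.smul_sum,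
        ← Finset.sum_add_distrib]
      refine Finset.sum_congr rfl fun j _ => ?_
      have h1 : (-1 : ℂ) ^ k * ((-1 : ℝ) ^ k : ℝ) = 1 := by
        push_cast
        rw [← mul_pow]; simp
      rw [QTorus.delta_mul, smul_add, form_add_left, ← mul_assoc v, mul_gen hv,
        smul_mul_assoc ((-1 : ℝ) ^ k) (gen j * v) w, form_smul_right, smul_smul, h1, one_smul,
        smul_mul_assoc, mul_smul_comm, mul_assoc]
  | zero => simp
  | add φ ψ _ _ h1 h2 => simp only [add_mul, map_add, h1, h2, smul_add]; abel
  | smul c φ _ h =>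
    simp only [smul_mul_assoc, map_smul, h, smul_add]
    rw [smul_comm]

/-- Stokes' formula: `δ_j` multiplies the constant coefficient by zero. -/
lemma integral_d (φ : Forms Ξ) : integral (d φ) = 0 := by
  induction φ using form_induction with
  | h0 => simp
  | ha φ ψ h1 h2 => simp only [map_add, h1, h2, add_zero]
  | hf x v =>
    rw [d_form, map_sum]
    refine Finset.sum_eq_zero fun j _ => ?_
    rw [integral_form, map_smul, QTorus.trace_delta, smul_zero, mul_zero]

/-- The integral is a graded trace: `τ₀` is cyclic, and a vector passes a `k`-vector with the sign
`(-1)^k`. -/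
lemma integral_mul_comm_of_mem_one {k : ℕ} {φ ψ : Forms Ξ} (hφ : φ ∈ deg Ξ 1) (hψ : ψ ∈ deg Ξ k) :
    integral (φ * ψ) = (-1 : ℂ) ^ k * integral (ψ * φ) := by
  induction hφ using Submodule.span_induction with
  | mem φ h =>
    obtain ⟨x, v, hv, rfl⟩ := h
    induction hψ using Submodule.span_induction with
    | mem ψ h =>
      obtain ⟨y, w, hw, rfl⟩ := h
      rw [form_mul, form_mul, integral_form, integral_form, mul_comm_of_mem_one hw hv, map_smul,
        QTorus.trace_mul_comm, smul_eq_mul]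
      push_cast
      ring
    | zero => simp
    | add φ ψ _ _ h1 h2 => simp only [mul_add, add_mul, map_add, h1, h2]
    | smul c φ _ h =>
      simp only [mul_smul_comm, smul_mul_assoc, map_smul, h, smul_eq_mul]; ring
  | zero => simp
  | add φ ψ _ _ h1 h2 => simp only [mul_add, add_mul, map_add, h1, h2]
  | smul c φ _ h =>
    simp only [mul_smul_comm, smul_mul_assoc, map_smul, h, smul_eq_mul]; ring

/-- Coordinates with values in the quantum torus, which reduce nondegeneracy of the inner product to
faithfulness of the trace. -/
lemma exists_eq_sum_basisExt {k : ℕ} {φ : Forms Ξ} (hφ : φ ∈ deg Ξ k) :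
    ∃ y : Finset (Fin n) → QTorus Ξ,
      φ = ∑ s with s.card = k, form (y s) (basisExt n s) := by
  induction hφ using Submodule.span_induction with
  | mem φ h =>
    obtain ⟨x, v, hv, rfl⟩ := h
    have hv' := exteriorPower_le_span n k hv
    clear hv
    induction hv' using Submodule.span_induction with
    | mem v h =>
      obtain ⟨s, hs, rfl⟩ := h
      refine ⟨Pi.single s x, ?_⟩
      rw [Finset.sum_eq_single_of_mem s (by simpa using hs), Pi.single_eq_same]
      intro t _ ht
      rw [Pi.single_eq_of_ne ht]
      exact TensorProduct.zero_tmul _ _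
    | zero => exact ⟨0, (TensorProduct.tmul_zero _ _).trans
        (Finset.sum_eq_zero fun s _ => TensorProduct.zero_tmul _ _).symm⟩
    | add v w _ _ h1 h2 =>
      obtain ⟨y, hy⟩ := h1
      obtain ⟨z, hz⟩ := h2
      refine ⟨y + z, (TensorProduct.tmul_add _ _ _).trans ?_⟩
      change form x v + form x w = _
      simp only [hy, hz, Pi.add_apply, form_add_left, Finset.sum_add_distrib]
    | smul r v _ h =>
      obtain ⟨y, hy⟩ := h
      refine ⟨(r : ℂ) • y, ?_⟩
      simp only [form_smul_right, hy, Pi.smul_apply, form_smul_left, Finset.smul_sum]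
  | zero => exact ⟨0, (Finset.sum_eq_zero fun s _ => TensorProduct.zero_tmul _ _).symm⟩
  | add φ ψ _ _ h1 h2 =>
    obtain ⟨y, hy⟩ := h1
    obtain ⟨z, hz⟩ := h2
    refine ⟨y + z, ?_⟩
    simp only [hy, hz, Pi.add_apply, form_add_left, Finset.sum_add_distrib]
  | smul c φ _ h =>
    obtain ⟨y, hy⟩ := h
    refine ⟨c • y, ?_⟩
    simp only [hy, Pi.smul_apply, form_smul_left, Finset.smul_sum]

/-! ### Nondegeneracy of the inner product of forms. -/

lemma ip_form_basisExt_self (x y : QTorus Ξ) (s : Finset (Fin n)) :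
    ip (form x (basisExt n s)) (form y (basisExt n s))
      = (complSign s : ℂ) ^ 2 * QTorus.trace (star x * y) := by
  rw [ip, starF_form, hodgeQ_form, form_mul, integral_form, hodge_basisExt, mul_smul_comm, map_smul]
  -- One sign comes from `⋆e_s`, the other from the top coefficient of `e_s ∧ e_{sᶜ}`.
  change ((complSign s • complSign s : ℝ) : ℂ) * _ = _
  rw [smul_eq_mul]
  push_cast
  ring

/-- If `s` were disjoint from `tᶜ` it would lie in `t`, hence equal `t` by cardinality. So `e_s` and
`e_{tᶜ}` share a factor and their product vanishes. -/
lemma ip_form_basisExt_of_ne (x y : QTorus Ξ) {s t : Finset (Fin n)} (hst : s.card = t.card)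
    (hne : s ≠ t) : ip (form x (basisExt n s)) (form y (basisExt n t)) = 0 := by
  have h : ¬Disjoint s tᶜ := fun h =>
    hne (Finset.eq_of_subset_of_card_le (disjoint_compl_right_iff.1 h) hst.ge)
  rw [ip, starF_form, hodgeQ_form, form_mul, integral_form, hodge_basisExt, mul_smul_comm,
    basisExt_mul_of_not_disjoint h]
  simp

/-- The inner product is nondegenerate in each degree. -/
lemma eq_zero_of_ip_eq_zero {k : ℕ} {η : Forms Ξ} (hη : η ∈ deg Ξ k)
    (h : ∀ φ ∈ deg Ξ k, ip φ η = 0) : η = 0 := by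
  obtain ⟨y, rfl⟩ := exists_eq_sum_basisExt hη
  refine Finset.sum_eq_zero fun s hs => ?_
  have hs' : s.card = k := by simpa using hs
  -- Test against the `s`-component of `η` itself; orthogonality leaves only the trace of `(y s)^*
  -- (y s)`.
  have h1 := h (form (y s) (basisExt n s)) (form_mem_deg _ (basisExt_mem hs'))
  have h2 : ip (form (y s) (basisExt n s)) (∑ t with t.card = k, form (y t) (basisExt n t))
      = ∑ t with t.card = k, ip (form (y s) (basisExt n s)) (form (y t) (basisExt n t)) := by
    simp only [ip, map_sum, Finset.mul_sum]
  rw [h2, Finset.sum_eq_single_of_mem s hs fun t ht hne =>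
    ip_form_basisExt_of_ne _ _ (hs'.trans (Finset.mem_filter.1 ht).2.symm) hne.symm,
    ip_form_basisExt_self] at h1
  have h3 : ((complSign s : ℝ) : ℂ) ^ 2 ≠ 0 :=
    pow_ne_zero _ (Complex.ofReal_ne_zero.2 (complSign_ne_zero s))
  rw [QTorus.eq_zero_of_trace_star_mul_self ((mul_eq_zero.1 h1).resolve_left h3)]
  exact TensorProduct.zero_tmul _ _

/-- The form `d⋆φ + μ ⋆φ + (-1)^(n-1) ⋆φ μ`. -/
def ymForm (μ : Forms Ξ) : Forms Ξ →ₗ[ℂ] Forms Ξ :=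
  (d + LinearMap.mulLeft ℂ μ + (-1 : ℂ) ^ (n - 1) • LinearMap.mulRight ℂ μ) ∘ₗ hodgeQ

lemma ymForm_apply (μ φ : Forms Ξ) : ymForm μ φ
    = d (hodgeQ φ) + μ * hodgeQ φ + (-1 : ℂ) ^ (n - 1) • (hodgeQ φ * μ) := rfl

lemma ymForm_mem_deg (hn : 2 ≤ n) {μ φ : Forms Ξ} (hμ : μ ∈ deg Ξ 1) (hφ : φ ∈ deg Ξ 2) :
    ymForm μ φ ∈ deg Ξ (n - 1) := by
  have h : hodgeQ φ ∈ deg Ξ (n - 2) := hodgeQ_mem_deg (by omega) hφ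
  -- These identities for truncated subtraction rely on `2 ≤ n`.
  have e1 : n - 2 + 1 = n - 1 := by omega
  have e2 : 1 + (n - 2) = n - 1 := by omega
  have h1 := d_mem_deg h
  have h2 := mul_mem_deg hμ h
  have h3 := mul_mem_deg h hμ
  rw [e1] at h1 h3
  rw [e2] at h2
  exact add_mem (add_mem h1 h2) (Submodule.smul_mem _ _ h3)

/-- The formal adjoint of `λ ↦ dλ + μ λ + λ μ`, tested against the inner product. -/
lemma ip_covariant_derivative (hn : 2 ≤ n) {μ ν φ : Forms Ξ} (hμ : μ ∈ deg Ξ 1)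
    (hμ' : starF μ = μ) (hν : ν ∈ deg Ξ 1) (hφ : φ ∈ deg Ξ 2) :
    ip (d ν + μ * ν + ν * μ) φ = -integral (starF ν * ymForm μ φ) := by
  have hψ : hodgeQ φ ∈ deg Ξ (n - 2) := hodgeQ_mem_deg (by omega) hφ
  have hν' := starF_mem_deg hν
  -- Stokes' formula for `ν^* ⋆φ`; since `ν^*` has degree one, the Leibniz sign cancels in moving
  -- `d` across.
  have h1 : integral (d (starF ν) * hodgeQ φ) = integral (starF ν * d (hodgeQ φ)) := by
    have h := integral_d (starF ν * hodgeQ φ)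
    rw [d_mul hν', map_add, map_smul, pow_one, smul_eq_mul] at h
    linear_combination h
  -- `ν^* ⋆φ` has degree `n - 1`, so cycling `μ` past it produces the sign `(-1)^(n-1)` of the
  -- Yang–Mills equation.
  have h2 : integral (μ * (starF ν * hodgeQ φ))
      = (-1 : ℂ) ^ (n - 1) * integral (starF ν * (hodgeQ φ * μ)) := by
    have e : 1 + (n - 2) = n - 1 := by omega
    have h := mul_mem_deg hν' hψ
    rw [e] at h
    rw [integral_mul_comm_of_mem_one hμ h, mul_assoc]
  rw [ip, map_add, map_add, starF_d, starF_mul_of_mem_one hμ hν, starF_mul_of_mem_one hν hμ, hμ',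
    ymForm_apply]
  simp only [add_mul, neg_mul, mul_add, map_add, map_neg, h1, mul_assoc, h2, mul_smul_comm,
    map_smul, smul_eq_mul]
  ring

end FormCalculus

/-! ## Sections of the adjoint bundle -/

/-! ### The germs map of `U(1)`. -/

lemma germ_one : germ 1 = 0 := by
  have h : projKer 1 = 0 := by
    refine Subtype.ext ?_
    change (1 : G) - algebraMap ℂ G (counitG 1) = 0
    simp
  change Complex.I • cls (projKer 1) = 0
  rw [h, map_zero, smul_zero]

/-- The germs map is a derivation at the unit, because `(g - ε(g))(h - ε(h))` lies in `Ker² ε`. -/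
lemma germ_mul (g h : G) : germ (g * h) = counitG h • germ g + counitG g • germ h := by
  let x : RingHom.ker counitG := ⟨projKer g, (projKer g).2⟩
  let y : RingHom.ker counitG := ⟨projKer h, (projKer h).2⟩
  have hxy : (RingHom.ker counitG).toCotangent (x • y) = 0 := by
    rw [Ideal.toCotangent_eq_zero, sq]
    exact Ideal.mul_mem_mul x.2 y.2
  have e : projKer (g * h) = counitG h • projKer g + counitG g • projKer h
      + (⟨((x • y : RingHom.ker counitG) : G), (x • y).2⟩ :
        (RingHom.ker counitG).restrictScalars ℂ) := by
    refine Subtype.ext ?_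
    change g * h - algebraMap ℂ G (counitG (g * h))
      = counitG h • (g - algebraMap ℂ G (counitG g)) + counitG g • (h - algebraMap ℂ G (counitG h))
        + (g - algebraMap ℂ G (counitG g)) * (h - algebraMap ℂ G (counitG h))
    rw [map_mul, map_mul, Algebra.smul_def, Algebra.smul_def]
    ring
  have e2 : cls (⟨((x • y : RingHom.ker counitG) : G), (x • y).2⟩ :
        (RingHom.ker counitG).restrictScalars ℂ) = 0 := hxy
  change Complex.I • cls (projKer (g * h))
    = counitG h • Complex.I • cls (projKer g) + counitG g • Complex.I • cls (projKer h)
  rw [e, map_add, map_add, e2, add_zero, map_smul, map_smul, smul_add, smul_comm Complex.I,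
    smul_comm Complex.I]

/-- Since `ε(z^k) = 1`, the derivation rule makes `k ↦ π(z^k)` additive on `ℤ`, so its value at `1`
determines it. -/
lemma germ_T (k : ℤ) : germ (LaurentPolynomial.T k) = (k : ℂ) • theta := by
  have hadd : ∀ k l : ℤ, germ (LaurentPolynomial.T (k + l))
      = germ (LaurentPolynomial.T k) + germ (LaurentPolynomial.T l) := fun k l => by
    rw [LaurentPolynomial.T_add, germ_mul, counitG_T, counitG_T, one_smul, one_smul]
  let f : ℤ →+ U1Dual := AddMonoidHom.mk' (fun k => germ (LaurentPolynomial.T k)) hadd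
  have h := map_zsmul f k 1
  rw [smul_eq_mul, mul_one] at h
  rw [Int.cast_smul_eq_zsmul]
  exact h

lemma germ_eq (g : G) : germ g = derivOne g • theta := by
  induction g using LaurentPolynomial.induction_on' with
  | add p q hp hq => rw [map_add, map_add, hp, hq, add_smul]
  | C_mul_T k a =>
    have e : (LaurentPolynomial.C a * LaurentPolynomial.T k : G) = a • LaurentPolynomial.T k :=
      (Algebra.smul_def a _).symm
    rw [e, map_smul, map_smul, germ_T, derivOne_T, smul_smul, smul_eq_mul]

lemma germ_surjective : Function.Surjective germ := by
  intro θ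
  obtain ⟨x, hx⟩ := (RingHom.ker counitG).toCotangent_surjective θ
  -- The factor `-i` undoes the factor `i` in the normalization of `π`.
  refine ⟨-Complex.I • (x : G), ?_⟩
  have h : projKer (x : G) = ⟨(x : G), x.2⟩ := by
    refine Subtype.ext ?_
    have hx : counitG (x : G) = 0 := x.2
    change (x : G) - algebraMap ℂ G (counitG (x : G)) = x
    rw [hx, map_zero, sub_zero]
  rw [map_smul]
  change -Complex.I • Complex.I • cls (projKer (x : G)) = θ
  rw [smul_smul, h, neg_mul, Complex.I_mul_I, neg_neg, one_smul]
  exact hx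

/-- The space of invariant forms is the line spanned by `ϑ`. -/
lemma coord_smul_theta (θ : U1Dual) : coord θ • theta = θ := by
  obtain ⟨g, rfl⟩ := germ_surjective θ
  rw [coord_germ, germ_eq]

/-! ### The trivialization of the adjoint bundle by `T^triv`. -/

section Adjoint

variable {n : ℕ} {Ξ : Matrix (Fin (n + 1)) (Fin (n + 1)) ℝ}

lemma secCoord_secTriv : secCoord (secTriv Ξ) = 1 := by
  change res (Sec.val (secTriv Ξ) theta) = 1
  rw [secTriv_theta, ← map_one (incl (Ξ := Ξ)), res_incl]

/-- The section `T^triv` generates `E_R`. -/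
lemma op_secCoord_smul_secTriv (T : Sec Ξ) :
    MulOpposite.op (secCoord T) • secTriv Ξ = T := by
  refine Sec.ext fun θ => ?_
  rw [sec_smul_apply, ← coord_smul_theta θ, map_smul, map_smul, secTriv_theta, incl_secCoord,
    smul_mul_assoc, one_mul]

lemma tens_eq (T : Sec Ξ) (μ : Forms (baseMat Ξ)) :
    tens T μ = tens (secTriv Ξ) (ofAlg (secCoord T) * μ) := by
  rw [← tens_smul_left, op_secCoord_smul_secTriv]

lemma evalForm_tens_secTriv (μ : Forms (baseMat Ξ)) : evalForm (tens (secTriv Ξ) μ) = μ := by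
  rw [evalForm_tens, secCoord_secTriv, map_one, one_mul]

/-- Together with `evalForm_tens_secTriv`, this identifies `E_R ⊗_B Ω^•(B)` with `Ω^•(B)`. -/
lemma tens_secTriv_evalForm (Φ : SecForms Ξ) : tens (secTriv Ξ) (evalForm Φ) = Φ := by
  induction Φ using secForms_induction with
  | h0 => rw [map_zero, ← tensL_apply, map_zero]
  | ht T μ => rw [evalForm_tens, ← tens_eq]
  | ha Φ Ψ h1 h2 =>
    rw [← tensL_apply, map_add, map_add, tensL_apply, tensL_apply, h1, h2]

lemma evalForm_mem_deg {k : ℕ} {Φ : SecForms Ξ} (hΦ : Φ ∈ secDeg Ξ k) :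
    evalForm Φ ∈ deg (baseMat Ξ) k := by
  induction hΦ using Submodule.span_induction with
  | mem Φ h =>
    obtain ⟨T, μ, hμ, rfl⟩ := h
    rw [evalForm_tens]
    have := mul_mem_deg (ofAlg_mem_deg (secCoord T)) hμ
    rwa [zero_add] at this
  | zero => rw [map_zero]; exact zero_mem _
  | add Φ Ψ _ _ h1 h2 => rw [map_add]; exact add_mem h1 h2
  | smul c Φ _ h => rw [map_smul]; exact Submodule.smul_mem _ _ h

/-- The form `λ` with `Λ(T^triv) = T^triv ⊗_B λ`. -/
def homForm {k : ℕ} : Hom Ξ k →ₗ[ℂ] Forms (baseMat Ξ) :=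
  evalForm ∘ₗ LinearMap.applyₗ (secTriv Ξ) ∘ₗ (Hom Ξ k).subtype

lemma homForm_apply {k : ℕ} (Λ : Hom Ξ k) : homForm Λ = evalForm (Λ.1 (secTriv Ξ)) := rfl

lemma homForm_mem_deg {k : ℕ} (Λ : Hom Ξ k) : homForm Λ ∈ deg (baseMat Ξ) k :=
  evalForm_mem_deg (Λ.2.1 _)

lemma apply_secTriv {k : ℕ} (Λ : Hom Ξ k) :
    Λ.1 (secTriv Ξ) = tens (secTriv Ξ) (homForm Λ) :=
  (tens_secTriv_evalForm _).symm

lemma ipHom_eq {k : ℕ} (Λ Λ' : Hom Ξ k) : ipHom Λ Λ' = ip (homForm Λ) (homForm Λ') := rfl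

/-- The right `B`-linear map with `T^triv ↦ T^triv ⊗_B λ`. -/
def formHom (k : ℕ) : deg (baseMat Ξ) k →ₗ[ℂ] Hom Ξ k where
  toFun ν := ⟨fmulL (tens (secTriv Ξ) ν) ∘ₗ ofAlg.toLinearMap ∘ₗ secCoord,
    -- An element of `B` is a form of degree `0`, and `k + 0` is `k` by definition.
    fun T => smul_mem_secDeg (l := 0) (Submodule.subset_span ⟨_, _, ν.2, rfl⟩) (ofAlg_mem_deg _),
    fun T b => by
      change MulOpposite.op (ofAlg (secCoord _) : Forms (baseMat Ξ)) • tens (secTriv Ξ) _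
        = _ • MulOpposite.op (ofAlg (secCoord T) : Forms (baseMat Ξ)) • tens (secTriv Ξ) _
      rw [secCoord_smul, map_mul, MulOpposite.op_mul, mul_smul]⟩
  map_add' ν ν' := Subtype.ext <| LinearMap.ext fun T => by
    change fmulL (tensL (secTriv Ξ) (ν + ν')) _ = fmulL (tensL _ ν) _ + fmulL (tensL _ ν') _
    rw [map_add, map_add, LinearMap.add_apply]
  map_smul' c ν := Subtype.ext <| LinearMap.ext fun T => by
    change fmulL (tensL (secTriv Ξ) (c • (ν : Forms (baseMat Ξ)))) _ = c • fmulL (tensL _ ν) _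
    rw [map_smul, map_smul, LinearMap.smul_apply]

lemma homForm_formHom {k : ℕ} (ν : deg (baseMat Ξ) k) : homForm (formHom k ν) = ν := by
  have h : (formHom k ν).1 (secTriv Ξ) = tens (secTriv Ξ) ν := by
    change MulOpposite.op (ofAlg (secCoord (secTriv Ξ)) : Forms (baseMat Ξ))
      • tens (secTriv Ξ) (ν : Forms (baseMat Ξ)) = _
    rw [secCoord_secTriv, map_one, MulOpposite.op_one, one_smul]
  rw [homForm_apply, h, evalForm_tens_secTriv]

/-! ## Connections in the trivialization -/

/-- Since `ad θ = θ ⊗ 1`, the connection form enters only through `ω(π(S(1))) = ω(π(1)) = 0`, and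
what remains is `d 1 = 0`. -/
lemma gaugeConn_secTriv (ω : QPC Ξ) : gaugeConn ω (secTriv Ξ) = 0 := by
  have h1 : covD ω (secTriv Ξ) theta = d (ofAlg (Sec.val (secTriv Ξ) theta))
      + ω.toFun (germ (HopfAlgebra.antipode ℂ (1 : G))) * ofAlg (Sec.val (secTriv Ξ) theta) := rfl
  have h2 : d (ofAlg (1 : QTorus Ξ)) = 0 := by
    have h := d_ofAlg_mul (1 : QTorus Ξ) 1
    rw [map_one, mul_one, mul_one, one_mul] at h
    rw [map_one]
    -- The Leibniz rule for `1 · 1` reads `d 1 = d 1 + d 1`.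
    exact left_eq_add.1 h
  rw [secTriv_theta, HopfAlgebra.antipode_one, germ_one, map_zero, zero_mul, add_zero, h2] at h1
  rw [gaugeConn, h1, map_zero, ← tensL_apply, map_zero]

namespace QLC

variable (D : QLC Ξ) {μ : Forms (baseMat Ξ)}

/-- For `T₁ = T₂ = T^triv` compatibility reads `μ - μ^* = d 1 = 0`. -/
lemma starF_eq_of_isCompatible (hD : D.IsCompatible)
    (hμ : D.toFun (secTriv Ξ) = tens (secTriv Ξ) μ) : starF μ = μ := by
  have h := hD (secTriv Ξ) (secTriv Ξ)
  have h1 : herm (secTriv Ξ) (secTriv Ξ) = 1 := by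
    rw [herm_eq, secCoord_secTriv, star_one, mul_one]
  have h2 : d (1 : Forms (baseMat Ξ)) = 0 := by
    have h := d_ofAlg_mul (1 : Base Ξ) 1
    rw [map_one, mul_one, mul_one, one_mul] at h
    exact left_eq_add.1 h
  rw [hμ, hermForm_tens, hermForm_tens, h1, starF_one, map_one ofAlg, h2] at h
  simp only [one_mul, mul_one] at h
  exact (sub_eq_zero.1 h).symm

lemma homForm_curv (hμ : D.toFun (secTriv Ξ) = tens (secTriv Ξ) μ) :
    homForm D.curv = d μ + μ * μ := by
  change evalForm (D.extD (D.toFun (secTriv Ξ))) = _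
  rw [hμ, extD_tens, hμ, smul_tens, map_add, evalForm_tens_secTriv, evalForm_tens_secTriv,
    add_comm]

/-- The term `μλ` comes from `d^∇` differentiating `T^triv`, and `λμ` from `Λ^ext`; its sign is
positive because `Λ` has degree one. -/
lemma homForm_comm (hμ : D.toFun (secTriv Ξ) = tens (secTriv Ξ) μ) (Λ : Hom Ξ 1) :
    homForm (D.comm Λ) = d (homForm Λ) + μ * homForm Λ + homForm Λ * μ := by
  change evalForm (D.extD (Λ.1 (secTriv Ξ))
    - (-1 : ℂ) ^ 1 • homExt Λ (D.toFun (secTriv Ξ))) = _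
  rw [hμ, homExt_tens, apply_secTriv, extD_tens, hμ, smul_tens, smul_tens, pow_one, neg_one_smul,
    sub_neg_eq_add, map_add, map_add, evalForm_tens_secTriv, evalForm_tens_secTriv,
    evalForm_tens_secTriv, add_comm (d _)]

/-- The formal adjoint of `Λ ↦ [∇, Λ]` for a connection with `∇(T^triv) = T^triv ⊗_B μ`. -/
def adjointComm (hn : 2 ≤ n) (hμ : μ ∈ deg (baseMat Ξ) 1) : Hom Ξ 2 →ₗ[ℂ] Hom Ξ 1 :=
  formHom 1 ∘ₗ LinearMap.codRestrict (deg (baseMat Ξ) 1) (-(hodgeInvQ ∘ₗ ymForm μ ∘ₗ homForm))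
    fun Φ => neg_mem (hodgeInvQ_mem_deg (by omega) (ymForm_mem_deg hn hμ (homForm_mem_deg Φ)))

lemma homForm_adjointComm (hn : 2 ≤ n) (hμ : μ ∈ deg (baseMat Ξ) 1) (Φ : Hom Ξ 2) :
    homForm (adjointComm hn hμ Φ) = -hodgeInvQ (ymForm μ (homForm Φ)) :=
  homForm_formHom _

/-- One direction must handle an arbitrary formal adjoint, which nondegeneracy controls; the other
supplies the explicit `adjointComm`. -/
theorem isYangMills_iff_ymForm_eq_zero (hn : 2 ≤ n) (hD : D.IsCompatible)
    (hμ1 : μ ∈ deg (baseMat Ξ) 1) (hμ : D.toFun (secTriv Ξ) = tens (secTriv Ξ) μ) :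
    D.IsYangMills ↔ ymForm μ (d μ + μ * μ) = 0 := by
  have hstar := D.starF_eq_of_isCompatible hD hμ
  have hcomm : ∀ (Λ : Hom Ξ 1) (Φ : Hom Ξ 2),
      ipHom (D.comm Λ) Φ = -integral (starF (homForm Λ) * ymForm μ (homForm Φ)) := fun Λ Φ => by
    rw [ipHom_eq, D.homForm_comm hμ,
      ip_covariant_derivative hn hμ1 hstar (homForm_mem_deg Λ) (homForm_mem_deg Φ)]
  rw [← D.homForm_curv hμ]
  constructor
  · rintro ⟨A, hA, h0⟩
    have hχ := ymForm_mem_deg hn hμ1 (homForm_mem_deg D.curv)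
    have hη := hodgeInvQ_mem_deg (l := 1) (by omega) hχ
    -- Writing the Yang–Mills form as `⋆η` with `η` a one-form, it suffices that `η` is orthogonal
    -- to every one-form `ν`.
    rw [← hodgeQ_hodgeInvQ (ymForm μ (homForm D.curv)), eq_zero_of_ip_eq_zero hη, map_zero]
    intro ν hν
    -- Every one-form `ν` arises from a right `B`-linear map, so the adjoint relation at the
    -- curvature can be tested on it.
    have h := hcomm (formHom 1 ⟨ν, hν⟩) D.curv
    rw [hA, h0, ipHom_eq, homForm_formHom, map_zero, ip, map_zero, mul_zero, map_zero] at h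
    rw [ip, hodgeQ_hodgeInvQ]
    exact neg_eq_zero.1 h.symm
  · intro h
    refine ⟨adjointComm hn hμ1, fun Λ Φ => ?_, ?_⟩
    · rw [hcomm, ipHom_eq, homForm_adjointComm, ip, map_neg, hodgeQ_hodgeInvQ, mul_neg, map_neg]
    · have hz : LinearMap.codRestrict (deg (baseMat Ξ) 1)
          (-(hodgeInvQ ∘ₗ ymForm μ ∘ₗ homForm (Ξ := Ξ) (k := 2)))
          (fun Φ => neg_mem (hodgeInvQ_mem_deg (by omega)
            (ymForm_mem_deg hn hμ1 (homForm_mem_deg Φ)))) D.curv = 0 := by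
        refine Subtype.ext ?_
        change -hodgeInvQ (ymForm μ (homForm D.curv)) = 0
        rw [h, map_zero, neg_zero]
      change formHom 1 _ = 0
      rw [hz, map_zero]

end QLC

end Adjoint

end QTor

end

theorem theorem6 (n : ℕ) (hn : 2 ≤ n) (Ξ : Matrix (Fin (n + 1)) (Fin (n + 1)) ℝ)
    (hΞ : Ξ.transpose = -Ξ) (ω : QPC Ξ) (D : QLC Ξ) (hD : D.IsCompatible)
    (Λ : Hom Ξ 1) (hΛ : ∀ T : Sec Ξ, D.toFun T = gaugeConn ω T + Λ.1 T)
    (μ : Forms (baseMat Ξ)) (hμ : μ ∈ deg (baseMat Ξ) 1)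
    (hΛμ : Λ.1 (secTriv Ξ) = tens (secTriv Ξ) μ) :
    D.IsYangMills ↔
      d (hodgeQ (d μ + μ * μ)) + μ * hodgeQ (d μ + μ * μ)
        + (-1) ^ (n - 1) * (hodgeQ (d μ + μ * μ) * μ) = 0 := by
  -- The gauge part vanishes on `T^triv`, so `μ` is the full connection form of `∇` in this
  -- trivialization.
  have hDμ : D.toFun (secTriv Ξ) = tens (secTriv Ξ) μ := by
    rw [hΛ, gaugeConn_secTriv, zero_add, hΛμ]
  -- The sign is a complex scalar in `ymForm` but an element of the algebra of forms in the goal.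
  rw [D.isYangMills_iff_ymForm_eq_zero hn hD hμ hDμ, ymForm_apply, Algebra.smul_def, map_pow,
    map_neg, map_one]
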